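/- **Setting.** Let $\mathcal G=(\mathcal V,\mathcal E)$ be a finite undirected simple graph with $n=|\mathcal V|$ nodes, features $\mathbf x_v\in\mathbb R^d$ and labels $y_v$ ($v\in\mathcal V$), and let $K\ge 0$ be a number of hops. *Topology reconstruction.* Starting from $\mathcal E$, in each of $T$ rounds every pair $(v,u)$ of a given candidate set with $\sigma((\mathrm{sim}_{vu}-\beta)/\tau)>\theta$ is added as an edge, where $\sigma$ is the sigmoid, $\tau>0$, and $\mathrm{sim}_{vu}=\omega_1\cos(\mathbf x_v,\mathbf x_u)+\omega_2\frac{|\mathcal N(v)\cap\mathcal N(u)|}{|\mathcal N(v)\cup\mathcal N(u)|}-\omega_3\|\mathbf x_v-\mathbf x_u\|_2^2$ with $\omega_i\ge 0$, $\mathcal N$ being the one-hop neighbourhoods in the current graph (candidates and parameters may change from round to round). Call the resulting graph $\widehat{\mathcal G}=(\mathcal V,\widehat{\mathcal E})$. *Distance pruning.* Let $\mathcal N^{(k)}(v)$ be the set of nodes at distance exactly $k$ from $v$ in $\widehat{\mathcal G}$, let $d^{(k)}_{vu}=\|\mathbf x_v-\mathbf x_u\|_2^2+\lambda_k\bigl(\beta_1k^2+\beta_2(1-\cos(\mathbf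 x_v,\mathbf x_u))\bigr)$ with $\lambda_k=\lambda_0e^{-\rho k}+\lambda_{\min}$, and let $\alpha_k(v)$ be the $p$-th percentile ($0<p<1$) of $\{d^{(k)}_{vu}\}_{u\in\mathcal N^{(k)}(v)}$, i.e. the least $t$ such that at least the fraction $p$ of these values is $\le t$. Put $\mathcal N^{(k)}_{\rm eff}(v)=\{u\in\mathcal N^{(k)}(v):d^{(k)}_{vu}\le\alpha_k(v)\}$, $\mathcal N_{\rm eff}(v)=\bigcup_{k=1}^K\mathcal N^{(k)}_{\rm eff}(v)$ and $d_{\rm eff}=\frac1n\sum_{v}|\mathcal N_{\rm eff}(v)|$. *Network.* For parameters $\Theta=(\mathbf W^{(1)},\dots,\mathbf W^{(K)}\in\mathbb R^{d'\times d},\ \mathbf a\in\mathbb R^{2d'},\ \phi\in\mathbb R^K)$ and any feature matrix $X=(\mathbf x_v)_v$ let $$\mathbf z_v^{\Theta}(X)=\sum_{k=1}^K\gamma_k\sum_{u\in\mathcal N^{(k)}_{\rm eff}(v)}\alpha^{(k)}_{vu}\,\mathbf W^{(k)}\mathbf x_u,$$ where $\gamma=\mathrm{softmax}(\phi)$ and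 $\alpha^{(k)}_{v\cdot}$ is the softmax over $u\in\mathcal N^{(k)}_{\rm eff}(v)$ of $\mathrm{LeakyReLU}(\mathbf a^\top[\mathbf W^{(k)}\mathbf x_v\,\|\,\mathbf W^{(k)}\mathbf x_u])/\tau_k$, with LeakyReLU slope in $(0,1)$ and $\tau_k=\tau_0e^{-\eta_0k}$, $\tau_0,\eta_0>0$. Let $\mathcal H_L$ be the set of $\Theta$ for which the network is $L$-Lipschitz in the input features: $\|\mathbf z^\Theta_v(X)-\mathbf z^\Theta_v(X')\|_2\le L\|X-X'\|_F$ for every $v$ and all $X,X'$ whose rows have norm at most $B$, the sets $\mathcal N^{(k)}_{\rm eff}(v)$ being held fixed. *Losses.* Let $\ell$ be a loss function that is $\Lambda$-Lipschitz in its first argument and takes values in $[0,M]$ on the outputs $(\mathbf z_v^\Theta(X),y_v)$, $\Theta\in\mathcal H_L$, where $X$ is the given feature matrix. The labelled set $\mathcal V_L$ is drawn uniformly at random among the subsets of $\mathcal V$ of a fixed size $m$, $1\le m\le n$, and $$\mathcal L_{\rm true}(\Theta)=\frac1n\sum_{v\in\mathcal V}\ell(\mathbf z^\Theta_v(X),y_v),\qquad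 \mathcal L_{\rm emp}(\Theta)=\frac1{|\mathcal V_L|}\sum_{v\in\mathcal V_L}\ell(\mathbf z^\Theta_v(X),y_v).$$ **Theorem.** For all $d,d',K$ and $L,B,M,\Lambda\ge 0$ there is a constant $C>0$, depending on these numbers only, such that the following holds. Let $\mathcal G$ be as above with $\|\mathbf x_v\|_2\le B$ for all $v$, and let $\mathcal G^*=(\mathcal V,\mathcal E^*)$ be a ground-truth graph that is structurally smooth: $\|\mathbf x_u-\mathbf x_v\|_2^2\le s$ for all $\{u,v\}\in\mathcal E^*$. Assume that $\mathcal G$ has an $\epsilon$-fraction of noisy edges, $|\mathcal E\setminus\mathcal E^*|=\epsilon|\mathcal E|$; that they are correctly removed, i.e. $u\notin\mathcal N_{\rm eff}(v)$ and $v\notin\mathcal N_{\rm eff}(u)$ for every $\{u,v\}\in\mathcal E\setminus\mathcal E^*$; and that an $\eta$-fraction of the missing valid edges, and no other edges, is added: $\widehat{\mathcal E}\setminus\mathcal E\subseteq\mathcal E^*$ and $|\widehat{\mathcal E}\setminus\mathcal E|=\eta\,|\mathcal E^*\setminus\mathcal E|$. Then for every $\delta\in(0,1)$, with probability at least $1-\delta$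 over $\mathcal V_L$, simultaneously for all $\Theta\in\mathcal H_L$, $$\mathcal L_{\rm true}(\Theta)\le\mathcal L_{\rm emp}(\Theta)+C\left(\sqrt{\frac{d_{\rm eff}\log n}{|\mathcal V_L|}}+\sqrt{\frac{\log(1/\delta)}{|\mathcal V_L|}}\right).$$ -/

import Mathlib

open scoped BigOperators

noncomputable section

namespace DRTR

/-- Feature space `ℝ^d` with the Euclidean norm. -/
abbrev Feat (d : ℕ) : Type := EuclideanSpace ℝ (Fin d)

/-- Cosine similarity of two feature vectors (equal to `0` if one of them vanishes). -/
def cosSim {d : ℕ} (a b : Feat d) : ℝ := inner ℝ a b / (‖a‖ * ‖b‖)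

/-! ### Topology Reconstructor -/

/-- Parameters of one round of edge addition: similarity weights `ω₁, ω₂, ω₃ ≥ 0`, similarity
threshold `β`, temperature `τ > 0`, probability threshold `θ`. -/
structure TRParams where
  ω₁ : ℝ
  ω₂ : ℝ
  ω₃ : ℝ
  β : ℝ
  τ : ℝ
  θ : ℝ
  ω₁_nonneg : 0 ≤ ω₁
  ω₂_nonneg : 0 ≤ ω₂
  ω₃_nonneg : 0 ≤ ω₃
  τ_pos : 0 < τ

/-- Jaccard similarity of the one-hop neighbourhoods. -/
def structuralSimilarity {V : Type*} (G : SimpleGraph V) (v u : V) : ℝ :=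
  ((G.neighborSet v ∩ G.neighborSet u).ncard : ℝ) /
    ((G.neighborSet v ∪ G.neighborSet u).ncard : ℝ)

/-- `sim_{vu}`: contextual alignment plus structural similarity minus squared distance. -/
def similarity {V : Type*} {d : ℕ} (P : TRParams) (G : SimpleGraph V) (x : V → Feat d)
    (v u : V) : ℝ :=
  P.ω₁ * cosSim (x v) (x u) + P.ω₂ * structuralSimilarity G v u - P.ω₃ * ‖x v - x u‖ ^ 2

/-- One round of edge addition: every candidate pair whose edge probability
`σ((sim - β) / τ)` exceeds `θ` becomes an (undirected) edge. -/
def addEdges {V : Type*} {d : ℕ} (P : TRParams) (x : V → Feat d) (cand : Set (V × V))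
    (G : SimpleGraph V) : SimpleGraph V :=
  G ⊔ SimpleGraph.fromRel (fun v u =>
    (v, u) ∈ cand ∧ P.θ < Real.sigmoid ((similarity P G x v u - P.β) / P.τ))

/-- The graph after `T` rounds of edge addition, with candidate sets `cand t` and parameters
`P t` in round `t`. -/
def reconstruct {V : Type*} {d : ℕ} (P : ℕ → TRParams) (x : V → Feat d)
    (cand : ℕ → Set (V × V)) (G : SimpleGraph V) : ℕ → SimpleGraph V
  | 0 => G
  | T + 1 => addEdges (P T) x (cand T) (reconstruct P x cand G T)

/-! ### Distance Recomputator -/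

/-- Parameters of the semantic distance and of the percentile pruning. -/
structure DRParams where
  lam₀ : ℝ
  rho : ℝ
  lamMin : ℝ
  β₁ : ℝ
  β₂ : ℝ
  /-- the pruning percentile, as a fraction -/
  p : ℝ
  p_pos : 0 < p
  p_lt_one : p < 1

/-- `λ_k = λ₀ exp(-ρ k) + λ_min`. -/
def DRParams.lam (P : DRParams) (k : ℕ) : ℝ := P.lam₀ * Real.exp (-P.rho * k) + P.lamMin

/-- `d_{vu}^{(k)} = ‖x_v - x_u‖² + λ_k (β₁ k² + β₂ (1 - cos(x_v, x_u)))`. -/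
def hopDist {V : Type*} {d : ℕ} (P : DRParams) (x : V → Feat d) (k : ℕ) (v u : V) : ℝ :=
  ‖x v - x u‖ ^ 2 + P.lam k * (P.β₁ * (k : ℝ) ^ 2 + P.β₂ * (1 - cosSim (x v) (x u)))

open Classical in
/-- The `k`-hop neighbourhood of `v`: the nodes at graph distance exactly `k`. It is used for
`k ≥ 1` only, where `G.dist v u = k` forces `u` to be reachable from `v` and different from it. -/
def hopNbr {V : Type*} [Fintype V] (G : SimpleGraph V) (k : ℕ) (v : V) : Finset V :=
  Finset.univ.filter (fun u => G.dist v u = k)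

open Classical in
/-- The `p`-th percentile of the family `(f u)_{u ∈ s}`: the least `t` such that at least the
fraction `p` of the values is `≤ t`. -/
def percentile {V : Type*} (p : ℝ) (s : Finset V) (f : V → ℝ) : ℝ :=
  sInf {t : ℝ | p * (s.card : ℝ) ≤ ((s.filter (fun u => f u ≤ t)).card : ℝ)}

open Classical in
/-- The `k`-hop neighbourhood after pruning at the `p`-th percentile of the distances. -/
def prunedNbr {V : Type*} [Fintype V] {d : ℕ} (P : DRParams) (x : V → Feat d)
    (G : SimpleGraph V) (k : ℕ) (v : V) : Finset V :=
  (hopNbr G k v).filter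
    (fun u => hopDist P x k v u ≤ percentile P.p (hopNbr G k v) (hopDist P x k v))

open Classical in
/-- The effective neighbourhood: the union of the pruned `k`-hop neighbourhoods, `1 ≤ k ≤ K`. -/
def effNbr {V : Type*} [Fintype V] {d : ℕ} (K : ℕ) (P : DRParams) (x : V → Feat d)
    (G : SimpleGraph V) (v : V) : Finset V :=
  (Finset.Icc 1 K).biUnion (fun k => prunedNbr P x G k v)

/-- The average effective degree. -/
def dEff {V : Type*} [Fintype V] {d : ℕ} (K : ℕ) (P : DRParams) (x : V → Feat d)
    (G : SimpleGraph V) : ℝ :=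
  (∑ v : V, ((effNbr K P x G v).card : ℝ)) / (Fintype.card V : ℝ)

/-! ### The multi-hop attention network -/

/-- Fixed hyperparameters of the attention: initial temperature, its decay rate, and the slope of
the leaky rectifier. -/
structure AttnHyper where
  τ₀ : ℝ
  decay : ℝ
  slope : ℝ
  τ₀_pos : 0 < τ₀
  decay_pos : 0 < decay
  slope_pos : 0 < slope
  slope_lt_one : slope < 1

/-- `τ_k = τ₀ exp(-η k)`. -/
def AttnHyper.temp (H : AttnHyper) (k : ℕ) : ℝ := H.τ₀ * Real.exp (-H.decay * k)

def leakyReLU (slope t : ℝ) : ℝ := if 0 ≤ t then t else slope * t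

/-- The learnable parameters: the matrices `W^{(k)}`, the shared attention vector
`a = (aSelf ‖ aNbr) ∈ ℝ^{2d'}`, and the logits `φ_k` of the hop weights; the index `i : Fin K`
stands for the hop `k = i + 1`. -/
structure Params (d d' K : ℕ) where
  W : Fin K → Feat d →L[ℝ] Feat d'
  aSelf : Feat d'
  aNbr : Feat d'
  φ : Fin K → ℝ

variable {d d' K : ℕ}

/-- The hop weights `γ_k`, a softmax of the `φ_k`. -/
def Params.hopWeight (Θ : Params d d' K) (i : Fin K) : ℝ :=
  Real.exp (Θ.φ i) / ∑ j, Real.exp (Θ.φ j)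

/-- The attention logit `LeakyReLU(aᵀ[W^{(k)} x_v ‖ W^{(k)} x_u]) / τ_k`. -/
def Params.logit (Θ : Params d d' K) (H : AttnHyper) (i : Fin K) (xv xu : Feat d) : ℝ :=
  leakyReLU H.slope (inner ℝ Θ.aSelf (Θ.W i xv) + inner ℝ Θ.aNbr (Θ.W i xu)) / H.temp (i + 1)

/-- The attention coefficient `α_{vu}^{(k)}` relative to the neighbour set `N`. -/
def Params.attn {V : Type*} (Θ : Params d d' K) (H : AttnHyper) (N : Finset V) (X : V → Feat d)
    (i : Fin K) (v u : V) : ℝ :=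
  Real.exp (Θ.logit H i (X v) (X u)) / ∑ w ∈ N, Real.exp (Θ.logit H i (X v) (X w))

/-- The representation
`z_v = ∑_k γ_k ∑_{u ∈ N^{(k)}(v)} α_{vu}^{(k)} W^{(k)} x_u` computed from the features `X` with
the neighbour sets `N k v`. -/
def Params.rep {V : Type*} (Θ : Params d d' K) (H : AttnHyper) (N : ℕ → V → Finset V)
    (X : V → Feat d) (v : V) : Feat d' :=
  ∑ i : Fin K, Θ.hopWeight i •
    ∑ u ∈ N (i + 1) v, Θ.attn H (N (i + 1) v) X i v u • Θ.W i (X u)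

/-- The network is `L`-Lipschitz in the input features on the set of feature matrices whose rows
are bounded by `B`, the neighbour sets being held fixed: each row of the output is `L`-Lipschitz
with respect to the Frobenius norm of the input. This is implied by Lipschitz continuity from the
Frobenius norm to the Frobenius norm, and from the maximum of the row norms to itself. -/
def Params.IsLipschitz {V : Type*} [Fintype V] (Θ : Params d d' K) (H : AttnHyper)
    (N : ℕ → V → Finset V) (B L : ℝ) : Prop :=
  ∀ X X' : V → Feat d, (∀ u, ‖X u‖ ≤ B) → (∀ u, ‖X' u‖ ≤ B) →
    ∀ v, ‖Θ.rep H N X v - Θ.rep H N X' v‖ ≤ L * Real.sqrt (∑ u, ‖X u - X' u‖ ^ 2)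

/-! ### Losses and probability -/

/-- The average loss of the representations `z` over a set `S` of nodes with labels `y`. -/
def avgLoss {V Y : Type*} (loss : Feat d' → Y → ℝ) (y : V → Y) (z : V → Feat d')
    (S : Finset V) : ℝ :=
  (∑ v ∈ S, loss (z v) (y v)) / (S.card : ℝ)

open Classical in
/-- The probability of the event `E` when the labelled set is drawn uniformly at random among all
subsets of `V` with `m` elements. -/
def labelProb {V : Type*} [Fintype V] (m : ℕ) (E : Finset V → Prop) : ℝ :=
  (((Finset.univ.powersetCard m).filter E).card : ℝ) /
    ((Finset.univ.powersetCard m : Finset (Finset V)).card : ℝ)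

end DRTR

end

/-! A node with empty effective neighbourhood has output 0 for every Θ. Hence only the losses on the
set S of active nodes (`activeNodes`) depend on Θ, and q = |S|/n is at most d_eff. Every loss
function is a fixed function off S plus a Θ-dependent one supported on S, with mean square O(q). For
nonnegative functions the lower tail is controlled by the second moment alone
(`labelProb_lower_tail`), so polynomially many functions deviate uniformly by O(√(q(log(1/δ) + log
n)/m)) on S. The single fixed part costs about √(log(1/δ)/m). Sampling without replacement is
handled by Maclaurin's inequality (`esymmSum_le`): the average of ∏ exp(-λ g(v)) over m-subsets is
an elementary symmetric mean.

The parameters themselves are unbounded, so a net in parameter norm is not available. The cover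
(`exists_finite_cover`) comes from sign patterns instead. The Lipschitz property bounds the messages
γ_k W^(k) x_u of every hop present (`Params.IsLipschitz.norm_hop_le`), so a finite grid locates
their coordinates. Softmax weights, even with unbounded logits, are determined up to O(n/R) by
comparing logit differences with log(j/R) (`abs_softmax_sub_softmax_le`). Both kinds of comparison
reduce to affine inequalities on a space of fixed dimension, where Sauer–Shelah leaves only n^O(1)
patterns (`card_signPatterns_le`). One Lipschitz representative per pattern approximates all outputs
within O(1/n), which is absorbed into √(d_eff log n / m) because m ≤ n. -/

namespace DRTR

/-! ### Maclaurin's inequality for elementary symmetric means. -/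

section Maclaurin

variable {V : Type*} [Fintype V]

/-- The elementary symmetric function of degree `m` in the values `a v`. -/
noncomputable def esymmSum (a : V → ℝ) (m : ℕ) : ℝ :=
  ∑ S ∈ (Finset.univ : Finset V).powersetCard m, ∏ v ∈ S, a v

open Classical in
/-- The part of the elementary symmetric function coming from the sets that contain `v`. -/
noncomputable def esymmAt (a : V → ℝ) (m : ℕ) (v : V) : ℝ :=
  ∑ S ∈ (Finset.univ : Finset V).powersetCard m with v ∈ S, ∏ w ∈ S, a w

lemma esymmSum_zero (a : V → ℝ) : esymmSum a 0 = 1 := by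
  simp [esymmSum]

lemma sum_esymmAt (a : V → ℝ) (m : ℕ) : ∑ v, esymmAt a m v = m * esymmSum a m := by
  classical
  simp only [esymmAt, esymmSum, Finset.sum_filter]
  rw [Finset.sum_comm, Finset.mul_sum]
  refine Finset.sum_congr rfl fun S hS => ?_
  rw [← Finset.sum_filter, Finset.sum_const, nsmul_eq_mul]
  simp [(Finset.mem_powersetCard.1 hS).2]

lemma sum_mul_esymmAt (a : V → ℝ) (m : ℕ) :
    ∑ v, a v * esymmAt a m v
      = ∑ S ∈ (Finset.univ : Finset V).powersetCard m, (∏ w ∈ S, a w) * ∑ v ∈ S, a v := by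
  classical
  simp only [esymmAt, Finset.sum_filter, Finset.mul_sum]
  rw [Finset.sum_comm]
  refine Finset.sum_congr rfl fun S hS => ?_
  simp only [mul_ite, mul_zero]
  rw [← Finset.sum_filter]
  simp [mul_comm]

/-- Double counting of pairs (S, v) with v ∈ S and |S| = m + 1: removing v leaves an m-set and a
point outside it. -/
lemma succ_mul_esymmSum_succ (a : V → ℝ) (m : ℕ) :
    ((m : ℝ) + 1) * esymmSum a (m + 1)
      = esymmSum a m * (∑ v, a v) - ∑ v, a v * esymmAt a m v := by
  classical
  have h1 : ((m : ℝ) + 1) * esymmSum a (m + 1)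
      = ∑ S ∈ (Finset.univ : Finset V).powersetCard (m + 1), ∑ v ∈ S, ∏ w ∈ S, a w := by
    rw [esymmSum, Finset.mul_sum]
    refine Finset.sum_congr rfl fun S hS => ?_
    simp [(Finset.mem_powersetCard.1 hS).2]
  have h2 : ∑ S ∈ (Finset.univ : Finset V).powersetCard (m + 1), ∑ v ∈ S, ∏ w ∈ S, a w
      = ∑ S ∈ (Finset.univ : Finset V).powersetCard m, ∑ v ∈ Sᶜ, (∏ w ∈ S, a w) * a v := by
    rw [Finset.sum_sigma', Finset.sum_sigma']
    refine Finset.sum_bij' (fun p _ => ⟨p.1.erase p.2, p.2⟩) (fun p _ => ⟨insert p.2 p.1, p.2⟩)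
      ?_ ?_ ?_ ?_ ?_
    · rintro ⟨S, v⟩ h
      simp only [Finset.mem_sigma, Finset.mem_powersetCard_univ] at h ⊢
      simp [Finset.card_erase_of_mem h.2, h.1]
    · rintro ⟨S, v⟩ h
      simp only [Finset.mem_sigma, Finset.mem_powersetCard_univ, Finset.mem_compl] at h ⊢
      simp [Finset.card_insert_of_notMem h.2, h.1]
    · rintro ⟨S, v⟩ h
      simp only [Finset.mem_sigma] at h
      simp [Finset.insert_erase h.2]
    · rintro ⟨S, v⟩ h
      simp only [Finset.mem_sigma, Finset.mem_compl] at h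
      simp [Finset.erase_insert h.2]
    · rintro ⟨S, v⟩ h
      simp only [Finset.mem_sigma] at h
      exact (Finset.prod_erase_mul _ _ h.2).symm
  rw [h1, h2, sum_mul_esymmAt, esymmSum, Finset.sum_mul, ← Finset.sum_sub_distrib]
  refine Finset.sum_congr rfl fun S _ => ?_
  rw [← Finset.mul_sum, ← Finset.sum_add_sum_compl S a]
  ring

/-- The transposition of u and v matches the sets containing u with those containing v; when only
one of the two lies in the set, it replaces the factor a u by the larger a v. -/
lemma monovary_esymmAt {a : V → ℝ} (ha : ∀ v, 0 ≤ a v) (m : ℕ) : Monovary a (esymmAt a m) := by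
  classical
  suffices h : ∀ u v, a u ≤ a v → esymmAt a m u ≤ esymmAt a m v by
    intro u v huv
    by_contra hlt
    exact absurd (h v u (not_le.1 hlt).le) (not_le.2 huv)
  intro u v huv
  let σ := Equiv.swap u v
  have hbij : esymmAt a m v
      = ∑ S ∈ (Finset.univ : Finset V).powersetCard m with u ∈ S, ∏ w ∈ S, a (σ w) := by
    symm
    refine Finset.sum_bij' (fun S _ => S.map σ.toEmbedding) (fun S _ => S.map σ.toEmbedding)
      ?_ ?_ ?_ ?_ ?_
    · intro S hS
      simp only [Finset.mem_filter, Finset.mem_powersetCard_univ, Finset.card_map,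
        Finset.mem_map_equiv] at hS ⊢
      simpa [σ] using hS
    · intro S hS
      simp only [Finset.mem_filter, Finset.mem_powersetCard_univ, Finset.card_map,
        Finset.mem_map_equiv] at hS ⊢
      simpa [σ] using hS
    · intro S _
      ext w
      simp [Finset.mem_map_equiv, σ]
    · intro S _
      ext w
      simp [Finset.mem_map_equiv, σ]
    · intro S _
      simp
  rw [hbij, esymmAt]
  refine Finset.sum_le_sum fun S hS => ?_
  have hu : u ∈ S := (Finset.mem_filter.1 hS).2
  by_cases hv : v ∈ S
  · refine (Equiv.Perm.prod_comp σ S a ?_).symm.le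
    intro w hw
    by_contra hwS
    refine hw (Equiv.swap_apply_of_ne_of_ne ?_ ?_)
    · rintro rfl; exact hwS hu
    · rintro rfl; exact hwS hv
  · refine Finset.prod_le_prod (fun w _ => ha w) fun w hw => ?_
    have hwv : w ≠ v := by rintro rfl; exact hv hw
    by_cases hwu : w = u
    · subst hwu; simpa [σ] using huv
    · simp [σ, Equiv.swap_apply_of_ne_of_ne hwu hwv]

/-- Chebyshev's sum inequality for the similarly ordered families a and `esymmAt a m`. This is the
inductive step of Maclaurin's inequality. -/
lemma card_mul_succ_mul_esymmSum_succ_le {a : V → ℝ} (ha : ∀ v, 0 ≤ a v) (m : ℕ) :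
    (Fintype.card V : ℝ) * (((m : ℝ) + 1) * esymmSum a (m + 1))
      ≤ ((Fintype.card V : ℝ) - m) * (esymmSum a m * ∑ v, a v) := by
  have h := (monovary_esymmAt ha m).sum_mul_sum_le_card_mul_sum
  rw [sum_esymmAt] at h
  rw [succ_mul_esymmSum_succ]
  nlinarith [h]

/-- Maclaurin's inequality between the elementary symmetric mean of degree `m` and the mean. -/
theorem esymmSum_le {a : V → ℝ} (ha : ∀ v, 0 ≤ a v) {m : ℕ} (hm : m ≤ Fintype.card V) :
    esymmSum a m ≤ ((Fintype.card V).choose m : ℝ) * ((∑ v, a v) / (Fintype.card V : ℝ)) ^ m := by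
  induction m with
  | zero => simp [esymmSum_zero]
  | succ m ih =>
    have ih := ih (by omega)
    have hn : (0 : ℝ) < Fintype.card V := by exact_mod_cast (by omega : 0 < Fintype.card V)
    have hm1 : (0 : ℝ) < (m : ℝ) + 1 := by positivity
    have hsum : 0 ≤ ∑ v, a v := Finset.sum_nonneg fun v _ => ha v
    have hnm : (0 : ℝ) ≤ (Fintype.card V : ℝ) - m := by
      have : (m : ℝ) ≤ Fintype.card V := by exact_mod_cast (by omega : m ≤ Fintype.card V)
      linarith
    have hchoose : ((Fintype.card V).choose (m + 1) : ℝ) * ((m : ℝ) + 1)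
        = ((Fintype.card V).choose m : ℝ) * ((Fintype.card V : ℝ) - m) := by
      have := Nat.choose_succ_right_eq (Fintype.card V) m
      rw [← Nat.cast_sub (by omega)]
      exact_mod_cast this
    have hstep := card_mul_succ_mul_esymmSum_succ_le ha m
    have hbound := mul_le_mul_of_nonneg_left (mul_le_mul_of_nonneg_right ih hsum) hnm
    refine le_of_mul_le_mul_left ?_ (mul_pos hn hm1)
    calc (Fintype.card V : ℝ) * ((m : ℝ) + 1) * esymmSum a (m + 1)
        = (Fintype.card V : ℝ) * (((m : ℝ) + 1) * esymmSum a (m + 1)) := by ring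
      _ ≤ _ := hstep.trans hbound
      _ = (((Fintype.card V).choose m : ℝ) * ((Fintype.card V : ℝ) - m))
            * (((∑ v, a v) / (Fintype.card V : ℝ)) ^ m * ∑ v, a v) := by ring
      _ = _ := by rw [← hchoose, pow_succ]; field_simp

end Maclaurin

/-! ### Chernoff bound for sampling without replacement. -/

section Tail

variable {V : Type*} [Fintype V]

/-- The product (1 + y + y²/2)(1 - y + y²/2) equals 1 + y⁴/4. Since y ≥ 0 suffices, the tail bound
below needs no upper bound on g. -/
lemma exp_neg_le_quadratic {y : ℝ} (hy : 0 ≤ y) : Real.exp (-y) ≤ 1 - y + y ^ 2 / 2 := by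
  have h := Real.quadratic_le_exp_of_nonneg hy
  have hpos : 0 < 1 + y + y ^ 2 / 2 := by positivity
  rw [Real.exp_neg]
  calc (Real.exp y)⁻¹ ≤ (1 + y + y ^ 2 / 2)⁻¹ := inv_anti₀ hpos h
    _ ≤ 1 - y + y ^ 2 / 2 := by
      rw [inv_le_iff_one_le_mul₀ hpos]
      nlinarith [sq_nonneg (y ^ 2)]

/-- Lower tail of the mean of a non-negative function over a uniformly random `m`-subset. -/
theorem labelProb_lower_tail {m : ℕ} (hm : 1 ≤ m) (hmn : m ≤ Fintype.card V) (g : V → ℝ)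
    (hg : ∀ v, 0 ≤ g v) {s t : ℝ} (hs : 0 < s) (ht : 0 ≤ t)
    (hgs : (∑ v, g v ^ 2) / (Fintype.card V : ℝ) ≤ s) :
    labelProb (V := V) m (fun S => t < (∑ v, g v) / (Fintype.card V : ℝ)
      - (∑ v ∈ S, g v) / (S.card : ℝ)) ≤ Real.exp (-(m * t ^ 2 / (2 * s))) := by
  classical
  have hn : (0 : ℝ) < Fintype.card V := by exact_mod_cast (by omega : 0 < Fintype.card V)
  have hm0 : (0 : ℝ) < m := by exact_mod_cast hm
  set μ := (∑ v, g v) / (Fintype.card V : ℝ) with hμ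
  -- The minimiser of the Chernoff exponent m(λ²s/2 - λt).
  set lam := t / s with hlam
  have hlam0 : 0 ≤ lam := by positivity
  set a : V → ℝ := fun v => Real.exp (-(lam * g v)) with ha
  have hmean : (∑ v, a v) / (Fintype.card V : ℝ) ≤ Real.exp (-(lam * μ) + lam ^ 2 * s / 2) := by
    have h1 : ∑ v, a v ≤ ∑ v, (1 - lam * g v + (lam * g v) ^ 2 / 2) :=
      Finset.sum_le_sum fun v _ => exp_neg_le_quadratic (mul_nonneg hlam0 (hg v))
    have h2 : ∑ v, (1 - lam * g v + (lam * g v) ^ 2 / 2)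
        = (Fintype.card V : ℝ) - lam * ∑ v, g v + lam ^ 2 / 2 * ∑ v, g v ^ 2 := by
      rw [Finset.sum_add_distrib, Finset.sum_sub_distrib, ← Finset.mul_sum]
      simp only [Finset.sum_const, Finset.card_univ, nsmul_eq_mul, mul_one]
      congr 1
      rw [Finset.mul_sum]
      exact Finset.sum_congr rfl fun v _ => by ring
    have h3 : (∑ v, a v) / (Fintype.card V : ℝ)
        ≤ 1 - lam * μ + lam ^ 2 / 2 * ((∑ v, g v ^ 2) / (Fintype.card V : ℝ)) := by
      rw [h2] at h1
      refine (div_le_div_of_nonneg_right h1 hn.le).trans_eq ?_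
      rw [hμ]; field_simp
    have h4 := mul_le_mul_of_nonneg_left hgs (by positivity : 0 ≤ lam ^ 2 / 2)
    have h5 := Real.add_one_le_exp (-(lam * μ) + lam ^ 2 * s / 2)
    linarith
  have hmac : esymmSum a m ≤ ((Fintype.card V).choose m : ℝ)
      * Real.exp (m * (-(lam * μ) + lam ^ 2 * s / 2)) := by
    refine (esymmSum_le (fun v => (Real.exp_pos _).le) hmn).trans ?_
    rw [Real.exp_nat_mul]
    have : 0 ≤ (∑ v, a v) / (Fintype.card V : ℝ) :=
      div_nonneg (Finset.sum_nonneg fun v _ => (Real.exp_pos _).le) hn.le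
    gcongr
  have hchoose : (0 : ℝ) < (Fintype.card V).choose m := by exact_mod_cast Nat.choose_pos hmn
  unfold labelProb
  rw [Finset.card_powersetCard, Finset.card_univ, div_le_iff₀ hchoose]
  have hcount : ((((Finset.univ : Finset V).powersetCard m).filter
      (fun S => t < μ - (∑ v ∈ S, g v) / (S.card : ℝ))).card : ℝ)
        * Real.exp (-(lam * (m * (μ - t)))) ≤ esymmSum a m := by
    rw [← nsmul_eq_mul, ← Finset.sum_const]
    refine le_trans (Finset.sum_le_sum fun S hS => ?_)
      (Finset.sum_le_sum_of_subset_of_nonneg (Finset.filter_subset _ _)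
        fun S _ _ => Finset.prod_nonneg fun v _ => (Real.exp_pos _).le)
    rw [Finset.mem_filter, Finset.mem_powersetCard_univ] at hS
    obtain ⟨hc, hS⟩ := hS
    rw [hc] at hS
    rw [ha, ← Real.exp_sum, Finset.sum_neg_distrib, ← Finset.mul_sum, Real.exp_le_exp]
    have : ∑ v ∈ S, g v ≤ m * (μ - t) := by
      rw [mul_comm, ← div_le_iff₀ hm0]; linarith
    have := mul_le_mul_of_nonneg_left this hlam0
    linarith
  have hle := hcount.trans hmac
  rw [← le_div_iff₀ (Real.exp_pos _), mul_div_assoc, ← Real.exp_sub, mul_comm] at hle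
  refine hle.trans_eq ?_
  congr 2
  rw [hlam]
  field_simp
  ring

end Tail

/-! ### VC dimension and sign patterns of affine functions. -/

section SignPatterns

/-- Affine inequalities on a space of dimension `D` shatter no set with more than `D + 1`
elements. -/
theorem card_le_of_shatters {E ι : Type*} [AddCommGroup E] [Module ℝ E]
    [FiniteDimensional ℝ E] [DecidableEq ι] (f : ι → E →ₗ[ℝ] ℝ) (θ : ι → ℝ)
    (𝒜 : Finset (Finset ι)) (h𝒜 : ∀ A ∈ 𝒜, ∃ e, ∀ i, i ∈ A ↔ θ i < f i e) {s : Finset ι}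
    (hs : 𝒜.Shatters s) : s.card ≤ Module.finrank ℝ E + 1 := by
  by_contra hlt
  -- At least D + 2 vectors (f i, θ i) lie in a space of dimension D + 1.
  have hdep : ¬ LinearIndependent ℝ (fun i : s => ((f i, θ i) : (E →ₗ[ℝ] ℝ) × ℝ)) := by
    intro hli
    have := hli.fintype_card_le_finrank
    rw [Module.finrank_prod, Module.finrank_self, Module.finrank_linearMap,
      Module.finrank_self, mul_one, Fintype.card_coe] at this
    exact hlt this
  rw [Fintype.not_linearIndependent_iff] at hdep
  have key : ∀ w : s → ℝ, ∑ i, w i • ((f i, θ i) : (E →ₗ[ℝ] ℝ) × ℝ) = 0 → ∀ i, w i ≤ 0 := by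
    intro w hw i₀
    by_contra hpos
    rw [not_le] at hpos
    -- Shattering realises the pattern {w > 0} by some e. Then every w i (f i e - θ i) is
    -- nonnegative and their sum is 0, although the term at i₀ is positive.
    obtain ⟨A, hA, hAs⟩ := hs (t := (Finset.univ.filter fun i : s => 0 < w i).map
      (Function.Embedding.subtype _)) (by intro j; simp; tauto)
    obtain ⟨e, he⟩ := h𝒜 A hA
    have hmem : ∀ i : s, 0 < w i ↔ θ i < f i e := by
      intro i
      rw [← he]
      have := Finset.ext_iff.1 hAs i
      simpa [i.2] using this.symm
    have h1 : ∑ i, w i • f i = 0 := by simpa [Prod.fst_sum] using congrArg Prod.fst hw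
    have h2 : ∑ i, w i * θ i = 0 := by simpa [Prod.snd_sum] using congrArg Prod.snd hw
    have h3 : ∑ i, w i * f i e = 0 := by
      simpa [LinearMap.sum_apply] using congrArg (fun l : E →ₗ[ℝ] ℝ => l e) h1
    have h4 : ∑ i, w i * (f i e - θ i) = 0 := by
      simp only [mul_sub, Finset.sum_sub_distrib, h2, h3, sub_zero]
    have hnn : ∀ i ∈ Finset.univ, 0 ≤ w i * (f i e - θ i) := by
      intro i _
      by_cases hi : 0 < w i
      · exact mul_nonneg hi.le (sub_nonneg.2 ((hmem i).1 hi).le)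
      · have := mt (hmem i).2 hi
        exact mul_nonneg_of_nonpos_of_nonpos (not_lt.1 hi) (by linarith)
    have h5 := (Finset.sum_eq_zero_iff_of_nonneg hnn).1 h4 i₀ (Finset.mem_univ _)
    have h6 := mul_pos hpos (sub_pos.2 ((hmem i₀).1 hpos))
    exact h6.ne' h5
  obtain ⟨w, hw, i, hi⟩ := hdep
  refine hi (le_antisymm (key w hw i) ?_)
  have hneg : ∑ i, (-w) i • ((f i, θ i) : (E →ₗ[ℝ] ℝ) × ℝ) = 0 := by
    rw [← neg_eq_zero, ← Finset.sum_neg_distrib, ← hw]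
    refine Finset.sum_congr rfl fun j _ => ?_
    ext <;> simp
  simpa using key (-w) hneg i

/-- The number of sign patterns of `P` affine functions on a space of dimension `D` is at most
`(D + 2) (P + 1) ^ (D + 1)`. -/
theorem card_signPatterns_le {E ι : Type*} [AddCommGroup E] [Module ℝ E]
    [FiniteDimensional ℝ E] [Fintype ι] (f : ι → E →ₗ[ℝ] ℝ) (θ : ι → ℝ)
    (𝒜 : Finset (Finset ι)) (h𝒜 : ∀ A ∈ 𝒜, ∃ e, ∀ i, i ∈ A ↔ θ i < f i e) :
    𝒜.card ≤ (Module.finrank ℝ E + 2) * (Fintype.card ι + 1) ^ (Module.finrank ℝ E + 1) := by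
  classical
  have hvc : 𝒜.vcDim ≤ Module.finrank ℝ E + 1 :=
    Finset.sup_le fun s hs => card_le_of_shatters f θ 𝒜 h𝒜 (Finset.mem_shatterer.1 hs)
  refine (Finset.card_le_card_shatterer 𝒜).trans (Finset.card_shatterer_le_sum_vcDim.trans ?_)
  calc ∑ k ∈ Finset.Iic 𝒜.vcDim, (Fintype.card ι).choose k
      ≤ ∑ k ∈ Finset.Iic (Module.finrank ℝ E + 1), (Fintype.card ι).choose k :=
        Finset.sum_le_sum_of_subset (Finset.Iic_subset_Iic.2 hvc)
    _ ≤ ∑ k ∈ Finset.Iic (Module.finrank ℝ E + 1),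
          (Fintype.card ι + 1) ^ (Module.finrank ℝ E + 1) :=
        Finset.sum_le_sum fun k hk => (Nat.choose_le_pow _ _).trans
          ((Nat.pow_le_pow_left (Nat.le_succ _) k).trans
            (Nat.pow_le_pow_right (Nat.succ_pos _) (Finset.mem_Iic.1 hk)))
    _ = _ := by simp

end SignPatterns

/-! ### Locating a real number by comparisons with a grid. -/

section Grid

lemma exists_int_div_between {a b R : ℝ} (hR : 0 < R) (h : b + 1 / R < a) :
    ∃ k : ℤ, b * R < k ∧ k < a * R := by
  refine ⟨⌊b * R⌋ + 1, ?_, ?_⟩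
  · push_cast; exact Int.lt_floor_add_one _
  · have h1 := Int.floor_le (b * R)
    have h2 := mul_lt_mul_of_pos_right h hR
    rw [add_mul, one_div, inv_mul_cancel₀ hR.ne'] at h2
    push_cast; linarith

/-- Two numbers that lie on the same side of all the points `k / R` with `l < k ≤ r` and that lie
in `[l / R, r / R]` have distance at most `1 / R`. -/
lemma abs_sub_le_of_grid {a b R : ℝ} (hR : 0 < R) {l r : ℤ} (ha : (l : ℝ) / R ≤ a)
    (ha' : a ≤ r / R) (hb : (l : ℝ) / R ≤ b) (hb' : b ≤ r / R)
    (h : ∀ k : ℤ, l < k → k ≤ r → ((k : ℝ) / R < a ↔ (k : ℝ) / R < b)) :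
    |a - b| ≤ 1 / R := by
  rw [div_le_iff₀ hR] at ha hb
  rw [le_div_iff₀ hR] at ha' hb'
  by_contra hlt
  rw [not_le, lt_abs] at hlt
  rcases hlt with hlt | hlt
  · obtain ⟨k, hk1, hk2⟩ := exists_int_div_between hR (by linarith : b + 1 / R < a)
    have hl : l < k := by exact_mod_cast hb.trans_lt hk1
    have hr : k < r := by exact_mod_cast hk2.trans_le ha'
    have := (h k hl hr.le).1 ((div_lt_iff₀ hR).2 hk2)
    rw [div_lt_iff₀ hR] at this
    linarith
  · obtain ⟨k, hk1, hk2⟩ := exists_int_div_between hR (by linarith : a + 1 / R < b)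
    have hl : l < k := by exact_mod_cast ha.trans_lt hk1
    have hr : k < r := by exact_mod_cast hk2.trans_le hb'
    have := (h k hl hr.le).2 ((div_lt_iff₀ hR).2 hk2)
    rw [div_lt_iff₀ hR] at this
    linarith

end Grid

/-! ### Stability of the softmax under threshold comparisons. -/

section Softmax

/-- The softmax weights are determined up to `(n + 1) / R` by the comparison of the differences of
the logits with the thresholds `log (j / R)`, `1 ≤ j ≤ R`. -/
theorem abs_softmax_sub_softmax_le {V : Type*} (N : Finset V) (e e' : V → ℝ) {R : ℕ}
    (hR : 0 < R)
    (h : ∀ w ∈ N, ∀ u ∈ N, ∀ j : Fin R, Real.log (((j : ℝ) + 1) / R) < e w - e u ↔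
      Real.log (((j : ℝ) + 1) / R) < e' w - e' u) {u : V} (hu : u ∈ N) :
    |Real.exp (e u) / ∑ w ∈ N, Real.exp (e w) - Real.exp (e' u) / ∑ w ∈ N, Real.exp (e' w)|
      ≤ ((N.card : ℝ) + 1) / R := by
  have hR0 : (0 : ℝ) < R := by exact_mod_cast hR
  -- Normalising by the largest logit puts all ratios in (0, 1] and makes the denominators at least
  -- 1.
  obtain ⟨t, htN, ht⟩ := N.exists_max_image e ⟨u, hu⟩
  have ht' : ∀ w ∈ N, e' w ≤ e' t := by
    intro w hw
    -- The last threshold is log 1 = 0, so the same t maximises e'.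
    have := (h w hw t htN ⟨R - 1, by omega⟩).not.1
    have hcast : (((R - 1 : ℕ) : ℝ) + 1) / R = 1 := by
      rw [Nat.cast_sub hR]; field_simp; simp
    simp only [hcast, Real.log_one, not_lt, sub_nonpos] at this
    exact this (ht w hw)
  have hnorm : ∀ f : V → ℝ, Real.exp (f u) / ∑ w ∈ N, Real.exp (f w)
      = Real.exp (f u - f t) / ∑ w ∈ N, Real.exp (f w - f t) := by
    intro f
    simp only [Real.exp_sub, ← Finset.sum_div]
    rw [div_div_div_cancel_right₀ (Real.exp_pos _).ne']
  rw [hnorm e, hnorm e']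
  set ρ : V → ℝ := fun w => Real.exp (e w - e t) with hρ
  set ρ' : V → ℝ := fun w => Real.exp (e' w - e' t) with hρ'
  have hclose : ∀ w ∈ N, |ρ w - ρ' w| ≤ 1 / R := by
    intro w hw
    refine abs_sub_le_of_grid hR0 (l := 0) (r := R) ?_ ?_ ?_ ?_ ?_
    · simpa using (Real.exp_pos _).le
    · simpa [hρ, hR0.ne'] using ht w hw
    · simpa using (Real.exp_pos _).le
    · simpa [hρ', hR0.ne'] using ht' w hw
    · intro k hk hkR
      lift k to ℕ using hk.le
      have hk1 : 1 ≤ k := by omega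
      have hkR' : k ≤ R := by exact_mod_cast hkR
      have hj := h w hw t htN ⟨k - 1, by omega⟩
      have hpos : (0 : ℝ) < (k : ℝ) / R := div_pos (by exact_mod_cast hk1) hR0
      have hcast : (((k - 1 : ℕ) : ℝ) + 1) / R = (k : ℝ) / R := by
        rw [Nat.cast_sub hk1]; simp
      simp only [hcast] at hj
      rw [Real.log_lt_iff_lt_exp hpos, Real.log_lt_iff_lt_exp hpos] at hj
      rw [Int.cast_natCast]
      exact hj
  set A := ∑ w ∈ N, ρ w with hA
  set A' := ∑ w ∈ N, ρ' w with hA'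
  have hA1 : 1 ≤ A := by
    have : ρ t ≤ A :=
      Finset.single_le_sum (f := ρ) (fun w _ => (Real.exp_pos _).le) htN
    simpa [hρ] using this
  have hA1' : 1 ≤ A' := by
    have : ρ' t ≤ A' :=
      Finset.single_le_sum (f := ρ') (fun w _ => (Real.exp_pos _).le) htN
    simpa [hρ'] using this
  have huA' : ρ' u ≤ A' :=
      Finset.single_le_sum (f := ρ') (fun w _ => (Real.exp_pos _).le) hu
  have hAA' : |A' - A| ≤ N.card / R := by
    rw [hA, hA', ← Finset.sum_sub_distrib]
    refine (Finset.abs_sum_le_sum_abs _ _).trans ?_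
    refine (Finset.sum_le_sum fun w hw => (abs_sub_comm _ _).trans_le (hclose w hw)).trans ?_
    simp [div_eq_mul_inv]
  have hρ'u : 0 < ρ' u := Real.exp_pos _
  have hsplit : ρ u / A - ρ' u / A' = (ρ u - ρ' u) / A + ρ' u / A' * ((A' - A) / A) := by
    field_simp; ring
  rw [hsplit]
  have h1 : |(ρ u - ρ' u) / A| ≤ 1 / R := by
    rw [abs_div, abs_of_pos (by linarith : 0 < A)]
    exact (div_le_self (abs_nonneg _) hA1).trans (hclose u hu)
  have h2 : |ρ' u / A' * ((A' - A) / A)| ≤ N.card / R := by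
    rw [abs_mul, abs_div (A' - A), abs_of_pos (by linarith : 0 < A)]
    have h3 : |ρ' u / A'| ≤ 1 := by
      rw [abs_of_nonneg (by positivity)]
      exact div_le_one_of_le₀ huA' (by linarith)
    calc |ρ' u / A'| * (|A' - A| / A) ≤ 1 * (|A' - A| / A) := by gcongr
      _ ≤ |A' - A| := by rw [one_mul]; exact div_le_self (abs_nonneg _) hA1
      _ ≤ _ := hAA'
  calc _ ≤ |(ρ u - ρ' u) / A| + |ρ' u / A' * ((A' - A) / A)| := abs_add_le _ _
    _ ≤ 1 / R + N.card / R := add_le_add h1 h2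
    _ = _ := by ring

lemma leakyReLU_eq_max {s : ℝ} (hs : s < 1) (t : ℝ) : leakyReLU s t = max t (s * t) := by
  unfold leakyReLU
  split_ifs with ht
  · rw [max_eq_left]; nlinarith
  · rw [max_eq_right]; nlinarith

end Softmax

/-! ### Finite cover of the Lipschitz networks. -/

section Network

variable {d d' K : ℕ} {V : Type*}

lemma Params.attn_nonneg (Θ : Params d d' K) (H : AttnHyper) (N : Finset V) (X : V → Feat d)
    (i : Fin K) (v u : V) : 0 ≤ Θ.attn H N X i v u :=
  div_nonneg (Real.exp_pos _).le (Finset.sum_nonneg fun _ _ => (Real.exp_pos _).le)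

lemma Params.sum_attn (Θ : Params d d' K) (H : AttnHyper) {N : Finset V} (hN : N.Nonempty)
    (X : V → Feat d) (i : Fin K) (v : V) : ∑ u ∈ N, Θ.attn H N X i v u = 1 := by
  simp only [Params.attn]
  rw [← Finset.sum_div, div_self]
  exact (Finset.sum_pos (fun _ _ => Real.exp_pos _) hN).ne'

lemma Params.rep_eq (Θ : Params d d' K) (H : AttnHyper) (N : ℕ → V → Finset V)
    (X : V → Feat d) (v : V) :
    Θ.rep H N X v = ∑ i : Fin K, ∑ u ∈ N (i + 1) v,
      Θ.attn H (N (i + 1) v) X i v u • Θ.hopWeight i • Θ.W i (X u) := by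
  simp only [Params.rep, Finset.smul_sum]
  refine Finset.sum_congr rfl fun i _ => Finset.sum_congr rfl fun u _ => smul_comm _ _ _

lemma AttnHyper.temp_pos (H : AttnHyper) (k : ℕ) : 0 < H.temp k :=
  mul_pos H.τ₀_pos (Real.exp_pos _)

/-- In a Lipschitz network every hop that is present at some node is bounded. -/
theorem Params.IsLipschitz.norm_hop_le [Fintype V] {Θ : Params d d' K} {H : AttnHyper}
    {N : ℕ → V → Finset V} {B L : ℝ} (hΘ : Θ.IsLipschitz H N B L) (hB : 0 ≤ B) (hL : 0 ≤ L)
    {v : V} (hN : ∀ k l, k ≠ l → Disjoint (N k v) (N l v)) {i : Fin K}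
    (hne : (N (i + 1) v).Nonempty) {y : Feat d} (hy : ‖y‖ ≤ B) :
    ‖Θ.hopWeight i • Θ.W i y‖ ≤ L * B * Fintype.card V := by
  classical
  have hcard : (1 : ℝ) ≤ Fintype.card V := by
    exact_mod_cast Fintype.card_pos_iff.2 ⟨v⟩
  -- Test input: y on hop i + 1 and 0 elsewhere. Attention weights sum to 1 and the hops are
  -- disjoint, so the output at v is exactly γ W y, however large the attention parameters are.
  set X : V → Feat d := fun u => if u ∈ N (i + 1) v then y else 0 with hX
  have hXB : ∀ u, ‖X u‖ ≤ B := by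
    intro u
    by_cases hu : u ∈ N (i + 1) v <;> simp [hX, hu, hy, hB]
  have hrep : Θ.rep H N X v = Θ.hopWeight i • Θ.W i y := by
    rw [Params.rep_eq, Finset.sum_eq_single i]
    · calc ∑ u ∈ N (i + 1) v, Θ.attn H (N (i + 1) v) X i v u • Θ.hopWeight i • Θ.W i (X u)
          = ∑ u ∈ N (i + 1) v, Θ.attn H (N (i + 1) v) X i v u • Θ.hopWeight i • Θ.W i y := by
            refine Finset.sum_congr rfl fun u hu => ?_
            have : X u = y := by simp [hX, hu]
            rw [this]
        _ = _ := by rw [← Finset.sum_smul, Params.sum_attn _ _ hne, one_smul]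
    · intro j _ hj
      refine Finset.sum_eq_zero fun u hu => ?_
      have hne' : ((j : ℕ) + 1) ≠ (i : ℕ) + 1 := by
        intro h; exact hj (Fin.ext (by omega))
      have : X u = 0 := by
        simp [hX, Finset.disjoint_left.1 (hN _ _ hne') hu]
      simp [this]
    · simp
  have hrep0 : Θ.rep H N (fun _ => 0) v = 0 := by simp [Params.rep]
  have h := hΘ X (fun _ => 0) hXB (by simpa using fun _ => hB) v
  rw [hrep, hrep0, sub_zero] at h
  refine h.trans ?_
  rw [mul_assoc]
  refine mul_le_mul_of_nonneg_left ?_ hL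
  rw [Real.sqrt_le_left (by positivity)]
  calc ∑ u, ‖X u - 0‖ ^ 2 ≤ ∑ _u : V, B ^ 2 := by
        refine Finset.sum_le_sum fun u _ => ?_
        rw [sub_zero]
        exact pow_le_pow_left₀ (norm_nonneg _) (hXB u) 2
    _ = Fintype.card V * B ^ 2 := by simp
    _ ≤ (B * Fintype.card V) ^ 2 := by
        rw [mul_pow, mul_comm]
        refine mul_le_mul_of_nonneg_left ?_ (sq_nonneg B)
        nlinarith

lemma norm_le_of_forall_abs_le {x : Feat d'} {ε : ℝ} (hε : 0 ≤ ε) (h : ∀ r, |x r| ≤ ε) :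
    ‖x‖ ≤ d' * ε := by
  rw [EuclideanSpace.norm_eq, Real.sqrt_le_left (by positivity)]
  calc ∑ r, ‖x r‖ ^ 2 ≤ ∑ _r : Fin d', ε ^ 2 :=
        Finset.sum_le_sum fun r _ => pow_le_pow_left₀ (norm_nonneg _) (h r) 2
    _ = d' * ε ^ 2 := by simp
    _ ≤ (d' * ε) ^ 2 := by
        rw [mul_pow]
        refine mul_le_mul_of_nonneg_right ?_ (sq_nonneg ε)
        have : d' ≤ d' ^ 2 := Nat.le_self_pow two_ne_zero d'
        exact_mod_cast this

/-- The space in which the output of the network depends on affine inequalities of the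
parameters. -/
abbrev ParamSpace (d d' K : ℕ) : Type :=
  Fin K → (Feat d →ₗ[ℝ] Feat d') × (Feat d →ₗ[ℝ] ℝ) × (Feat d →ₗ[ℝ] ℝ)

/-- Recording the products γ W, ⟨aSelf, W ·⟩ and ⟨aNbr, W ·⟩ as independent coordinates makes
messages and rectifier arguments linear, although they are not linear in Θ. -/
noncomputable def Params.toSpace (Θ : Params d d' K) : ParamSpace d d' K := fun i =>
  (Θ.hopWeight i • (Θ.W i : Feat d →ₗ[ℝ] Feat d'),
    (innerₛₗ ℝ Θ.aSelf) ∘ₗ (Θ.W i : Feat d →ₗ[ℝ] Feat d'),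
    (innerₛₗ ℝ Θ.aNbr) ∘ₗ (Θ.W i : Feat d →ₗ[ℝ] Feat d'))

/-- The argument of the leaky rectifier, as a linear form. -/
def preLogit (i : Fin K) (xv xu : Feat d) : ParamSpace d d' K →ₗ[ℝ] ℝ where
  toFun e := (e i).2.1 xv + (e i).2.2 xu
  map_add' e f := by simp; ring
  map_smul' c e := by simp; ring

/-- A coordinate of the message `γ_k W^{(k)} x_u`, as a linear form. -/
def messageCoord (i : Fin K) (xu : Feat d) (r : Fin d') : ParamSpace d d' K →ₗ[ℝ] ℝ where
  toFun e := (e i).1 xu r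
  map_add' e f := by simp
  map_smul' c e := by simp

/-- The indices of the affine inequalities which determine the output of the network up to a
small error: comparisons of attention logits, and comparisons of message coordinates. -/
abbrev CellIndex (d' K : ℕ) (V : Type*) (R J : ℕ) : Type _ :=
  (Fin K × V × V × V × Bool × Bool × Fin R) ⊕ (Fin K × V × Fin d' × Fin (2 * J + 1))

/-- The Booleans p and q select the branches of the two leaky rectifiers. -/
noncomputable def cellForm (H : AttnHyper) (x : V → Feat d) (R J : ℕ) :
    CellIndex d' K V R J → ParamSpace d d' K →ₗ[ℝ] ℝ
  | .inl (i, v, w, u, p, q, _) =>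
      (if p then 1 else H.slope) • preLogit i (x v) (x w)
        - (if q then 1 else H.slope) • preLogit i (x v) (x u)
  | .inr (i, u, r, _) => messageCoord i (x u) r

/-- The temperature is moved to the threshold side. The second family is the grid of mesh 1/n from
-J/n to J/n. -/
noncomputable def cellThreshold (H : AttnHyper) (n R J : ℕ) : CellIndex d' K V R J → ℝ
  | .inl (i, _, _, _, _, _, j) => Real.log (((j : ℝ) + 1) / R) * H.temp (i + 1)
  | .inr (_, _, _, j) => ((j : ℝ) - J) / n

open Classical in
/-- The set of the affine inequalities that hold for given parameters. -/
noncomputable def Params.cell [Fintype V] (Θ : Params d d' K) (H : AttnHyper) (x : V → Feat d)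
    (n R J : ℕ) : Finset (CellIndex d' K V R J) :=
  Finset.univ.filter fun c => cellThreshold H n R J c < cellForm H x R J c Θ.toSpace

lemma Params.logit_eq (Θ : Params d d' K) (H : AttnHyper) (i : Fin K) (xv xu : Feat d) :
    Θ.logit H i xv xu
      = max (preLogit i xv xu Θ.toSpace) (H.slope * preLogit i xv xu Θ.toSpace)
        / H.temp (i + 1) := by
  rw [Params.logit, leakyReLU_eq_max H.slope_lt_one]
  rfl

/-- A slope below 1 makes the rectifier a maximum of two linear functions. A difference of maxima
exceeds a threshold when some branch of the first does so against every branch of the second. -/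
lemma Params.lt_logit_sub_logit_iff (Θ : Params d d' K) (H : AttnHyper) (i : Fin K)
    (xv xw xu : Feat d) (t : ℝ) :
    t < Θ.logit H i xv xw - Θ.logit H i xv xu ↔
      ∃ p : Bool, ∀ q : Bool, t * H.temp (i + 1) <
        (if p then 1 else H.slope) * preLogit i xv xw Θ.toSpace
          - (if q then 1 else H.slope) * preLogit i xv xu Θ.toSpace := by
  rw [Params.logit_eq, Params.logit_eq, ← sub_div, lt_div_iff₀ (H.temp_pos _),
    lt_sub_iff_add_lt, lt_max_iff, ← lt_sub_iff_add_lt', ← lt_sub_iff_add_lt', max_lt_iff,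
    max_lt_iff]
  simp only [Bool.exists_bool, Bool.forall_bool, if_true, Bool.false_eq_true, if_false, one_mul]
  constructor
  · rintro (⟨h1, h2⟩ | ⟨h1, h2⟩)
    · right; constructor <;> linarith
    · left; constructor <;> linarith
  · rintro (⟨h1, h2⟩ | ⟨h1, h2⟩)
    · right; constructor <;> linarith
    · left; constructor <;> linarith

lemma Params.mem_cell [Fintype V] {Θ : Params d d' K} {H : AttnHyper} {x : V → Feat d}
    {n R J : ℕ} {c : CellIndex d' K V R J} :
    c ∈ Θ.cell H x n R J ↔ cellThreshold H n R J c < cellForm H x R J c Θ.toSpace := by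
  simp [Params.cell]

section SameCell

variable [Fintype V] {Θ Θ' : Params d d' K} {H : AttnHyper} {x : V → Feat d} {n R J : ℕ}

lemma Params.abs_attn_sub_attn_le (h : Θ.cell H x n R J = Θ'.cell H x n R J) (hR : 0 < R)
    (N : Finset V) (i : Fin K) (v : V) {u : V} (hu : u ∈ N) :
    |Θ.attn H N x i v u - Θ'.attn H N x i v u| ≤ ((N.card : ℝ) + 1) / R := by
  refine abs_softmax_sub_softmax_le N (fun u => Θ.logit H i (x v) (x u))
    (fun u => Θ'.logit H i (x v) (x u)) hR (fun w _ u _ j => ?_) hu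
  rw [Params.lt_logit_sub_logit_iff, Params.lt_logit_sub_logit_iff]
  refine exists_congr fun p => forall_congr' fun q => ?_
  have := Finset.ext_iff.1 h (.inl (i, v, w, u, p, q, j))
  simpa only [Params.mem_cell, cellThreshold, cellForm, LinearMap.sub_apply,
    LinearMap.smul_apply, smul_eq_mul] using this

lemma Params.norm_message_sub_le (h : Θ.cell H x n R J = Θ'.cell H x n R J) (hn : 0 < n)
    (i : Fin K) (u : V) (hb : ‖Θ.hopWeight i • Θ.W i (x u)‖ ≤ (J : ℝ) / n)
    (hb' : ‖Θ'.hopWeight i • Θ'.W i (x u)‖ ≤ (J : ℝ) / n) :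
    ‖Θ.hopWeight i • Θ.W i (x u) - Θ'.hopWeight i • Θ'.W i (x u)‖ ≤ d' * (1 / n) := by
  have hn0 : (0 : ℝ) < n := by exact_mod_cast hn
  refine norm_le_of_forall_abs_le (by positivity) fun r => ?_
  have hc := abs_le.1 ((PiLp.norm_apply_le _ r).trans hb)
  have hc' := abs_le.1 ((PiLp.norm_apply_le _ r).trans hb')
  rw [PiLp.sub_apply]
  refine abs_sub_le_of_grid hn0 (l := -J) (r := J) ?_ ?_ ?_ ?_ ?_
  · push_cast; rw [neg_div]; exact hc.1
  · rw [Int.cast_natCast]; exact hc.2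
  · push_cast; rw [neg_div]; exact hc'.1
  · rw [Int.cast_natCast]; exact hc'.2
  · intro k hk hkJ
    obtain ⟨j, hj⟩ : ∃ j : ℕ, k + J = j := Int.eq_ofNat_of_zero_le (by omega)
    have hkj : (k : ℝ) = (j : ℝ) - J := by
      rw [eq_sub_iff_add_eq]; exact_mod_cast hj
    have := Finset.ext_iff.1 h (.inr (i, u, r, ⟨j, by omega⟩))
    rw [hkj]
    simp only [Params.mem_cell, cellThreshold, cellForm] at this
    exact this

/-- Networks with parameters in the same cell have almost the same output. -/
theorem Params.norm_rep_sub_rep_le {N : ℕ → V → Finset V} {B L : ℝ} (hB : 0 ≤ B) (hL : 0 ≤ L)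
    (hN : ∀ v k l, k ≠ l → Disjoint (N k v) (N l v)) (hx : ∀ v, ‖x v‖ ≤ B)
    (hΘ : Θ.IsLipschitz H N B L) (hΘ' : Θ'.IsLipschitz H N B L)
    (hn : n = Fintype.card V) (hJ : L * B * n ^ 2 ≤ J) (hR : R = n ^ 4)
    (h : Θ.cell H x n R J = Θ'.cell H x n R J) (v : V) :
    ‖Θ.rep H N x v - Θ'.rep H N x v‖ ≤ K * (2 * (L * B) + d') / n := by
  have hnpos : 0 < n := hn ▸ Fintype.card_pos_iff.2 ⟨v⟩
  have hn0 : (0 : ℝ) < n := by exact_mod_cast hnpos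
  have hn1 : (1 : ℝ) ≤ n := by exact_mod_cast hnpos
  have hLB : 0 ≤ L * B := mul_nonneg hL hB
  have hhop : ∀ i : Fin K, ‖∑ u ∈ N (i + 1) v,
      (Θ.attn H (N (i + 1) v) x i v u • Θ.hopWeight i • Θ.W i (x u)
        - Θ'.attn H (N (i + 1) v) x i v u • Θ'.hopWeight i • Θ'.W i (x u))‖
      ≤ (2 * (L * B) + d') / n := by
    intro i
    rcases (N (i + 1) v).eq_empty_or_nonempty with he | hne
    -- An absent hop has no bound on its message, but contributes nothing.
    · rw [he, Finset.sum_empty, norm_zero]; positivity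
    have hcard : ((N (i + 1) v).card : ℝ) ≤ n := by
      rw [hn]; exact_mod_cast Finset.card_le_univ _
    have hm : ∀ u, ‖Θ.hopWeight i • Θ.W i (x u)‖ ≤ L * B * n := fun u => by
      rw [hn]; exact hΘ.norm_hop_le hB hL (hN v) hne (hx u)
    have hm' : ∀ u, ‖Θ'.hopWeight i • Θ'.W i (x u)‖ ≤ L * B * n := fun u => by
      rw [hn]; exact hΘ'.norm_hop_le hB hL (hN v) hne (hx u)
    have hJn : L * B * n ≤ (J : ℝ) / n := by
      rw [le_div_iff₀ hn0]; linarith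
    -- The attention error is summed crudely over up to n neighbours, giving O(n³/R), hence R = n⁴.
    -- The message error keeps the weights of Θ', which sum to 1, so it gains no factor n.
    have hterm : ∀ u ∈ N (i + 1) v,
        ‖Θ.attn H (N (i + 1) v) x i v u • Θ.hopWeight i • Θ.W i (x u)
          - Θ'.attn H (N (i + 1) v) x i v u • Θ'.hopWeight i • Θ'.W i (x u)‖
        ≤ (n + 1) / R * (L * B * n)
          + Θ'.attn H (N (i + 1) v) x i v u * (d' * (1 / n)) := by
      intro u hu
      have hsplit : Θ.attn H (N (i + 1) v) x i v u • Θ.hopWeight i • Θ.W i (x u)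
          - Θ'.attn H (N (i + 1) v) x i v u • Θ'.hopWeight i • Θ'.W i (x u)
          = (Θ.attn H (N (i + 1) v) x i v u - Θ'.attn H (N (i + 1) v) x i v u)
              • (Θ.hopWeight i • Θ.W i (x u))
            + Θ'.attn H (N (i + 1) v) x i v u
              • (Θ.hopWeight i • Θ.W i (x u) - Θ'.hopWeight i • Θ'.W i (x u)) := by
        rw [sub_smul, smul_sub]; abel
      rw [hsplit]
      refine (norm_add_le _ _).trans (add_le_add ?_ ?_)
      · rw [norm_smul]
        refine mul_le_mul ?_ (hm u) (norm_nonneg _) (by positivity)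
        refine (Params.abs_attn_sub_attn_le h (hR ▸ by positivity) _ i v hu).trans ?_
        gcongr
      · rw [norm_smul, Real.norm_of_nonneg (Params.attn_nonneg _ _ _ _ _ _ _)]
        exact mul_le_mul_of_nonneg_left (Params.norm_message_sub_le h hnpos i u
          ((hm u).trans hJn) ((hm' u).trans hJn)) (Params.attn_nonneg _ _ _ _ _ _ _)
    refine (norm_sum_le_of_le _ hterm).trans ?_
    rw [Finset.sum_add_distrib, Finset.sum_const, nsmul_eq_mul, ← Finset.sum_mul,
      Params.sum_attn _ _ hne, add_div (2 * (L * B)), one_mul, ← mul_one_div (d' : ℝ)]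
    refine add_le_add ?_ le_rfl
    calc ((N (i + 1) v).card : ℝ) * ((n + 1) / R * (L * B * n))
        ≤ n * ((n + n) / R * (L * B * n)) := by gcongr
      _ = 2 * (L * B) / n := by
          rw [hR]; push_cast; field_simp; ring
  rw [Params.rep_eq, Params.rep_eq, ← Finset.sum_sub_distrib]
  simp only [← Finset.sum_sub_distrib]
  refine (norm_sum_le_of_le _ fun i _ => hhop i).trans_eq ?_
  simp [mul_div_assoc]

end SameCell

/-- The power 7 comes from the node triples times R = n⁴ in the logit comparisons; the message grid
has only order n³ elements. -/
lemma card_cellIndex_add_one_le [Fintype V] [Nonempty V] (c : ℕ) :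
    Fintype.card (CellIndex d' K V (Fintype.card V ^ 4) (c * Fintype.card V ^ 2)) + 1
      ≤ (4 * K + K * d' * (2 * c + 1) + 1) * Fintype.card V ^ 7 := by
  have hn : 1 ≤ Fintype.card V := Fintype.card_pos
  simp only [CellIndex, Fintype.card_sum, Fintype.card_prod, Fintype.card_fin, Fintype.card_bool]
  generalize Fintype.card V = n at hn
  have h1 : 1 ≤ n ^ 7 := Nat.one_le_pow _ _ hn
  have h2 : n * (2 * (c * n ^ 2) + 1) ≤ (2 * c + 1) * n ^ 7 := by
    have h3 : n ^ 3 ≤ n ^ 7 := Nat.pow_le_pow_right hn (by norm_num)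
    have h4 : n ≤ n ^ 7 := Nat.le_self_pow (by norm_num) n
    nlinarith [Nat.mul_le_mul_left (2 * c) h3]
  have h5 := Nat.mul_le_mul_left (K * d') h2
  nlinarith

/-- A finite family of Lipschitz networks, of size polynomial in the number of nodes, that
approximates all Lipschitz networks at the given features. -/
theorem exists_finite_cover [Fintype V] [Nonempty V] (H : AttnHyper) {N : ℕ → V → Finset V}
    {B L : ℝ} (hB : 0 ≤ B) (hL : 0 ≤ L) (hN : ∀ v k l, k ≠ l → Disjoint (N k v) (N l v))
    {x : V → Feat d} (hx : ∀ v, ‖x v‖ ≤ B) :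
    ∃ 𝒯 : Finset (Params d d' K),
      𝒯.card ≤ (Module.finrank ℝ (ParamSpace d d' K) + 2) *
        ((4 * K + K * d' * (2 * ⌈L * B⌉₊ + 1) + 1) * Fintype.card V ^ 7)
          ^ (Module.finrank ℝ (ParamSpace d d' K) + 1) ∧
      (∀ Θ ∈ 𝒯, Θ.IsLipschitz H N B L) ∧
      ∀ Θ : Params d d' K, Θ.IsLipschitz H N B L → ∃ Θ' ∈ 𝒯,
        ∀ v, ‖Θ.rep H N x v - Θ'.rep H N x v‖
          ≤ K * (2 * (L * B) + d') / Fintype.card V := by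
  classical
  set n := Fintype.card V with hn
  set R := n ^ 4 with hR
  set J := ⌈L * B⌉₊ * n ^ 2 with hJ
  let 𝒜 : Finset (Finset (CellIndex d' K V R J)) :=
    Finset.univ.filter fun A => ∃ Θ : Params d d' K, Θ.IsLipschitz H N B L ∧ Θ.cell H x n R J = A
  have h𝒜 : ∀ A ∈ 𝒜, ∃ Θ : Params d d' K, Θ.IsLipschitz H N B L ∧ Θ.cell H x n R J = A :=
    fun A hA => (Finset.mem_filter.1 hA).2
  have : Nonempty (Params d d' K) := ⟨⟨0, 0, 0, 0⟩⟩
  -- Representatives are themselves Lipschitz, so that the range assumption on the loss applies to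
  -- them.
  choose! rp hrp using h𝒜
  refine ⟨𝒜.image rp, ?_, ?_, ?_⟩
  · refine Finset.card_image_le.trans ((card_signPatterns_le (cellForm H x R J)
      (cellThreshold H n R J) 𝒜 fun A hA => ⟨(rp A).toSpace, fun c => ?_⟩).trans ?_)
    · rw [← Params.mem_cell, (hrp A hA).2]
    · exact Nat.mul_le_mul_left _ (Nat.pow_le_pow_left (card_cellIndex_add_one_le _) _)
  · intro Θ hΘ
    obtain ⟨A, hA, rfl⟩ := Finset.mem_image.1 hΘ
    exact (hrp A hA).1
  · intro Θ hΘ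
    have hA : Θ.cell H x n R J ∈ 𝒜 := Finset.mem_filter.2 ⟨Finset.mem_univ _, Θ, hΘ, rfl⟩
    refine ⟨_, Finset.mem_image_of_mem _ hA, fun v => ?_⟩
    refine Params.norm_rep_sub_rep_le hB hL hN hx hΘ (hrp _ hA).1 hn ?_ hR (hrp _ hA).2.symm v
    rw [hJ]
    push_cast
    exact mul_le_mul_of_nonneg_right (Nat.le_ceil _) (by positivity)

end Network
-- Union bound and uniform deviation.
section UniformDeviation

variable {V : Type*} [Fintype V]

lemma labelProb_mono {m : ℕ} {E F : Finset V → Prop} (h : ∀ S, S.card = m → E S → F S) :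
    labelProb m E ≤ labelProb m F := by
  classical
  unfold labelProb
  refine div_le_div_of_nonneg_right ?_ (Nat.cast_nonneg _)
  exact_mod_cast Finset.card_le_card fun S hS => by
    rw [Finset.mem_filter, Finset.mem_powersetCard_univ] at hS ⊢
    exact ⟨hS.1, h S hS.1 hS.2⟩

/-- The union bound. -/
lemma one_sub_le_labelProb {ι : Type*} {m : ℕ} (hm : m ≤ Fintype.card V) {E F : Finset V → Prop}
    (𝒯 : Finset ι) (F' : ι → Finset V → Prop)
    (h : ∀ S, S.card = m → ¬ F S → (∀ j ∈ 𝒯, ¬ F' j S) → E S) :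
    1 - (labelProb m F + ∑ j ∈ 𝒯, labelProb m (F' j)) ≤ labelProb m E := by
  classical
  have hc : (0 : ℝ) < ((Finset.univ : Finset V).powersetCard m).card := by
    rw [Finset.card_powersetCard, Finset.card_univ]
    exact_mod_cast Nat.choose_pos hm
  have hsub : (Finset.univ : Finset V).powersetCard m ⊆
      ((Finset.univ.powersetCard m).filter E ∪ (Finset.univ.powersetCard m).filter F)
        ∪ 𝒯.biUnion fun j => (Finset.univ.powersetCard m).filter (F' j) := by
    intro S hS
    simp only [Finset.mem_union, Finset.mem_filter, Finset.mem_biUnion, hS, true_and]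
    by_contra hcon
    push Not at hcon
    exact hcon.1.1 (h S (Finset.mem_powersetCard_univ.1 hS) hcon.1.2 hcon.2)
  have hcard : (((Finset.univ : Finset V).powersetCard m).card : ℝ)
      ≤ ((Finset.univ.powersetCard m).filter E).card
        + ((Finset.univ.powersetCard m).filter F).card
        + ∑ j ∈ 𝒯, (((Finset.univ.powersetCard m).filter (F' j)).card : ℝ) := by
    have h1 := (Finset.card_le_card hsub).trans ((Finset.card_union_le _ _).trans
      (add_le_add (Finset.card_union_le _ _) Finset.card_biUnion_le))
    exact_mod_cast h1
  unfold labelProb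
  rw [← Finset.sum_div, ← add_div, one_sub_div hc.ne']
  refine div_le_div_of_nonneg_right ?_ hc.le
  linarith

/-- Both terms are compared with log n / n. This lets the two failure probabilities add up to δ
itself: an additive log 2 / m from splitting δ in half could not be absorbed when δ is near 1 and q
is near 1/n. -/
lemma exp_neg_log_div_add_exp_neg_log_le {n : ℝ} (hn : 2 ≤ n) :
    Real.exp (-(2 * (1 / n) * Real.log n)) + Real.exp (-(2 * Real.log n)) ≤ 1 := by
  have hn0 : 0 < n := by linarith
  have hlog2 : (1 : ℝ) / 2 ≤ Real.log 2 := by linarith [Real.log_two_gt_d9]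
  have hlogn : Real.log 2 ≤ Real.log n := Real.log_le_log (by norm_num) hn
  have hlog : Real.log n ≤ n / 2 := by
    have h1 := Real.log_le_sub_one_of_pos (by positivity : 0 < n / 2)
    rw [Real.log_div hn0.ne' (by norm_num)] at h1
    linarith [Real.log_two_lt_d9]
  have h1 : Real.exp (-(2 * (1 / n) * Real.log n)) ≤ 1 - Real.log n / n := by
    have hy0 : 0 ≤ 2 * (1 / n) * Real.log n := by
      have : 0 ≤ Real.log n := by linarith
      positivity
    have hy1 : 2 * (1 / n) * Real.log n ≤ 1 := by
      rw [mul_one_div, div_mul_eq_mul_div, div_le_one hn0]; linarith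
    have h2 : Real.log n / n = 2 * (1 / n) * Real.log n / 2 := by field_simp
    rw [h2]
    refine (exp_neg_le_quadratic hy0).trans ?_
    nlinarith
  have h3 : Real.exp (-(2 * Real.log n)) ≤ Real.log n / n := by
    have h4 : Real.exp (-(2 * Real.log n)) = (n ^ 2)⁻¹ := by
      rw [Real.exp_neg, mul_comm, ← Real.rpow_def_of_pos hn0]; norm_num
    rw [h4, inv_eq_one_div, div_le_div_iff₀ (by positivity) hn0]
    nlinarith
  linarith

lemma exp_neg_add_log_one_div {δ : ℝ} (hδ : 0 < δ) (t : ℝ) :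
    Real.exp (-(Real.log (1 / δ) + t)) = δ * Real.exp (-t) := by
  rw [one_div, Real.log_inv, neg_add, neg_neg, Real.exp_add, Real.exp_log hδ]

/-- Uniform deviation bound for a polynomial number of bounded functions that differ from a fixed
function on the set `S` only. -/
theorem one_sub_le_labelProb_forall_mean_le {ι : Type*} (𝒯 : Finset ι) (g : ι → V → ℝ)
    (h : V → ℝ) (S : Finset V) (hS : S.Nonempty) {b δ : ℝ} (hb : 0 < b)
    (hg0 : ∀ j ∈ 𝒯, ∀ v, 0 ≤ g j v) (hgb : ∀ j ∈ 𝒯, ∀ v, g j v ≤ b)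
    (hh0 : ∀ v, 0 ≤ h v) (hhb : ∀ v, h v ≤ b) (hgh : ∀ j ∈ 𝒯, ∀ v ∉ S, g j v = h v)
    {m c : ℕ} (hm : 1 ≤ m) (hmn : m ≤ Fintype.card V) (hn : 2 ≤ Fintype.card V)
    (h𝒯 : 𝒯.card ≤ Fintype.card V ^ c) (hδ : 0 < δ) (hδ1 : δ < 1) {q : ℝ}
    (hq : q = (S.card : ℝ) / Fintype.card V) :
    1 - δ ≤ labelProb (V := V) m (fun U => ∀ j ∈ 𝒯,
      (∑ v, g j v) / (Fintype.card V : ℝ) ≤ (∑ v ∈ U, g j v) / (U.card : ℝ)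
        + b * √(2 * (Real.log (1 / δ) + 2 * q * Real.log (Fintype.card V)) / m)
        + b * √(2 * q * (Real.log (1 / δ) + (c + 2) * Real.log (Fintype.card V)) / m)) := by
  classical
  set n := Fintype.card V with hn'
  have hn2 : (2 : ℝ) ≤ n := by exact_mod_cast hn
  have hn0 : (0 : ℝ) < n := by linarith
  have hm0 : (0 : ℝ) < m := by exact_mod_cast hm
  have hlog : 0 ≤ Real.log n := Real.log_nonneg (by linarith)
  have hlogδ : 0 ≤ Real.log (1 / δ) := Real.log_nonneg (by rw [le_div_iff₀ hδ]; linarith)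
  have hqn : 1 / (n : ℝ) ≤ q := by
    rw [hq]
    refine div_le_div_of_nonneg_right ?_ hn0.le
    exact_mod_cast hS.card_pos
  have hq0 : 0 < q := lt_of_lt_of_le (by positivity) hqn
  -- The fixed part fails with probability at most δ n^(-2q), which leaves room for δ n^(-2) from
  -- the n^c functions supported on S.
  set t₁ := b * √(2 * (Real.log (1 / δ) + 2 * q * Real.log n) / m) with ht₁
  set t₂ := b * √(2 * q * (Real.log (1 / δ) + (c + 2) * Real.log n) / m) with ht₂
  set f : V → ℝ := fun v => if v ∈ S then 0 else h v with hf
  set k : ι → V → ℝ := fun j v => if v ∈ S then g j v else 0 with hk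
  have hsplit : ∀ j ∈ 𝒯, ∀ v, g j v = f v + k j v := by
    intro j hj v
    by_cases hv : v ∈ S
    · simp [hf, hk, hv]
    · simp [hf, hk, hv, hgh j hj v hv]
  have hf0 : ∀ v, 0 ≤ f v := by
    intro v
    simp only [hf]
    split_ifs
    exacts [le_rfl, hh0 v]
  have hk0 : ∀ j ∈ 𝒯, ∀ v, 0 ≤ k j v := by
    intro j hj v
    simp only [hk]
    split_ifs
    exacts [hg0 j hj v, le_rfl]
  have hfs : (∑ v, f v ^ 2) / (n : ℝ) ≤ b ^ 2 := by
    rw [div_le_iff₀ hn0]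
    calc ∑ v, f v ^ 2 ≤ ∑ _v : V, b ^ 2 := by
          refine Finset.sum_le_sum fun v _ => pow_le_pow_left₀ (hf0 v) ?_ 2
          simp only [hf]
          split_ifs
          exacts [hb.le, hhb v]
      _ = b ^ 2 * n := by simp [hn', mul_comm]
  have hks : ∀ j ∈ 𝒯, (∑ v, k j v ^ 2) / (n : ℝ) ≤ b ^ 2 * q := by
    intro j hj
    rw [hq, ← mul_div_assoc]
    refine div_le_div_of_nonneg_right ?_ hn0.le
    calc ∑ v, k j v ^ 2 = ∑ v ∈ S, g j v ^ 2 := by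
          simp only [hk, ite_pow, ne_eq, OfNat.ofNat_ne_zero, not_false_eq_true, zero_pow]
          rw [← Finset.sum_filter]; simp
      _ ≤ ∑ _v ∈ S, b ^ 2 :=
          Finset.sum_le_sum fun v _ => pow_le_pow_left₀ (hg0 j hj v) (hgb j hj v) 2
      _ = b ^ 2 * S.card := by simp [mul_comm]
  have h1 := labelProb_lower_tail hm hmn f hf0 (s := b ^ 2) (t := t₁) (by positivity)
    (by positivity) hfs
  have h2 := fun j (hj : j ∈ 𝒯) => labelProb_lower_tail hm hmn (k j) (hk0 j hj)
    (s := b ^ 2 * q) (t := t₂) (by positivity) (by positivity) (hks j hj)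
  have e1 : (m : ℝ) * t₁ ^ 2 / (2 * b ^ 2) = Real.log (1 / δ) + 2 * q * Real.log n := by
    rw [ht₁, mul_pow, Real.sq_sqrt (by positivity)]
    field_simp
  have e2 : (m : ℝ) * t₂ ^ 2 / (2 * (b ^ 2 * q))
      = Real.log (1 / δ) + (c + 2) * Real.log n := by
    rw [ht₂, mul_pow, Real.sq_sqrt (by positivity)]
    field_simp
  rw [e1, exp_neg_add_log_one_div hδ] at h1
  simp only [e2, exp_neg_add_log_one_div hδ] at h2
  have h1' : Real.exp (-(2 * q * Real.log n)) ≤ Real.exp (-(2 * (1 / n) * Real.log n)) := by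
    rw [Real.exp_le_exp, neg_le_neg_iff]
    gcongr
  have h2' : ∑ j ∈ 𝒯, δ * Real.exp (-((c + 2) * Real.log n))
      ≤ δ * Real.exp (-(2 * Real.log n)) := by
    rw [Finset.sum_const, nsmul_eq_mul, mul_left_comm]
    refine mul_le_mul_of_nonneg_left ?_ hδ.le
    have h3 : (𝒯.card : ℝ) ≤ Real.exp (c * Real.log n) := by
      rw [Real.exp_nat_mul, Real.exp_log hn0]
      exact_mod_cast h𝒯
    calc (𝒯.card : ℝ) * Real.exp (-((c + 2) * Real.log n))
        ≤ Real.exp (c * Real.log n) * Real.exp (-((c + 2) * Real.log n)) := by gcongr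
      _ = Real.exp (-(2 * Real.log n)) := by rw [← Real.exp_add]; ring_nf
  refine le_trans ?_ (one_sub_le_labelProb hmn 𝒯
    (fun j U => t₂ < (∑ v, k j v) / (n : ℝ) - (∑ v ∈ U, k j v) / (U.card : ℝ))
    (F := fun U => t₁ < (∑ v, f v) / (n : ℝ) - (∑ v ∈ U, f v) / (U.card : ℝ)) ?_)
  · have h4 := Finset.sum_le_sum h2
    have h5 := exp_neg_log_div_add_exp_neg_log_le hn2
    have h6 := mul_le_mul_of_nonneg_left h1' hδ.le
    have h7 := mul_le_mul_of_nonneg_left h5 hδ.le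
    linarith
  · intro U _ hF hF' j hj
    have hF2 := hF' j hj
    rw [not_lt] at hF hF2
    rw [Finset.sum_congr rfl fun v _ => hsplit j hj v,
      Finset.sum_congr (s₁ := U) rfl fun v _ => hsplit j hj v, Finset.sum_add_distrib,
      Finset.sum_add_distrib, add_div, add_div]
    linarith

end UniformDeviation

/-! ### Active nodes and the average effective degree. -/

section Effective

variable {V : Type*} [Fintype V] {d : ℕ}

lemma dist_eq_of_mem_prunedNbr {P : DRParams} {x : V → Feat d} {G : SimpleGraph V} {v u : V}
    {k : ℕ} (h : u ∈ prunedNbr P x G k v) : G.dist v u = k :=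
  (Finset.mem_filter.1 (Finset.mem_filter.1 h).1).2

lemma disjoint_prunedNbr (P : DRParams) (x : V → Feat d) (G : SimpleGraph V) (v : V) (k l : ℕ)
    (h : k ≠ l) : Disjoint (prunedNbr P x G k v) (prunedNbr P x G l v) := by
  rw [Finset.disjoint_left]
  intro u hk hl
  exact h ((dist_eq_of_mem_prunedNbr hk).symm.trans (dist_eq_of_mem_prunedNbr hl))

lemma Params.rep_eq_zero_of_effNbr_eq_empty {d' K : ℕ} (Θ : Params d d' K) (H : AttnHyper)
    (P : DRParams) (x X : V → Feat d) (G : SimpleGraph V) {v : V} (h : effNbr K P x G v = ∅) :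
    Θ.rep H (prunedNbr P x G) X v = 0 := by
  refine Finset.sum_eq_zero fun i _ => ?_
  have hi : prunedNbr P x G (i + 1) v = ∅ := by
    classical
    rw [← Finset.subset_empty, ← h, effNbr]
    exact Finset.subset_biUnion_of_mem (fun k => prunedNbr P x G k v)
      (Finset.mem_Icc.2 ⟨by omega, by omega⟩)
  simp [hi]

open Classical in
/-- The nodes with a non-empty effective neighbourhood. -/
noncomputable def activeNodes (K : ℕ) (P : DRParams) (x : V → Feat d) (G : SimpleGraph V) :
    Finset V :=
  Finset.univ.filter fun v => (effNbr K P x G v).Nonempty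

/-- Each active node contributes at least 1 to the sum of effective degrees. -/
lemma card_activeNodes_div_le_dEff (K : ℕ) (P : DRParams) (x : V → Feat d)
    (G : SimpleGraph V) :
    ((activeNodes K P x G).card : ℝ) / Fintype.card V ≤ dEff K P x G := by
  refine div_le_div_of_nonneg_right ?_ (Nat.cast_nonneg _)
  rw [Finset.card_eq_sum_ones, activeNodes, Finset.sum_filter]
  push_cast
  refine Finset.sum_le_sum fun v _ => ?_
  split_ifs with h
  · exact_mod_cast h.card_pos
  · positivity

lemma Params.rep_eq_zero_of_notMem_activeNodes {d' K : ℕ} (Θ : Params d d' K) (H : AttnHyper)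
    (P : DRParams) (x X : V → Feat d) (G : SimpleGraph V) {v : V}
    (h : v ∉ activeNodes K P x G) : Θ.rep H (prunedNbr P x G) X v = 0 := by
  refine Θ.rep_eq_zero_of_effNbr_eq_empty H P x X G ?_
  simpa [activeNodes] using h

lemma two_le_card_of_mem_activeNodes {K : ℕ} {P : DRParams} {x : V → Feat d}
    {G : SimpleGraph V} {v : V} (h : v ∈ activeNodes K P x G) : 2 ≤ Fintype.card V := by
  classical
  obtain ⟨u, hu⟩ := (Finset.mem_filter.1 h).2
  obtain ⟨k, hk, hu⟩ := Finset.mem_biUnion.1 hu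
  refine Fintype.one_lt_card_iff.2 ⟨v, u, ?_⟩
  rintro rfl
  have h1 := (Finset.mem_Icc.1 hk).1
  have h2 := dist_eq_of_mem_prunedNbr hu
  rw [SimpleGraph.dist_self] at h2
  omega

end Effective

/-! ### Constants and final estimates. -/

/-- The exponent in the polynomial bound for the size of the finite cover. -/
noncomputable def coverExponent (d d' K : ℕ) (L B : ℝ) : ℕ :=
  (Module.finrank ℝ (ParamSpace d d' K) + 2)
    + (4 * K + K * d' * (2 * ⌈L * B⌉₊ + 1) + 1 + 7) * (Module.finrank ℝ (ParamSpace d d' K) + 1)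

/-- Constant factors move into the exponent by k ≤ 2^k ≤ n^k. -/
lemma mul_pow_le_pow_add {n : ℕ} (hn : 2 ≤ n) (p a r : ℕ) :
    p * (a * n ^ 7) ^ r ≤ n ^ (p + (a + 7) * r) := by
  have hle : ∀ k, k ≤ n ^ k := fun k =>
    (Nat.lt_two_pow_self).le.trans (Nat.pow_le_pow_left hn k)
  rw [pow_add, pow_mul, pow_add n a]
  exact Nat.mul_le_mul (hle p) (Nat.pow_le_pow_left (Nat.mul_le_mul_right _ (hle a)) _)

/-- Elementary estimate of the two deviation terms and of the discretization error. -/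
lemma deviation_le {D q ld ln n m b c e : ℝ} (hn : 2 ≤ n) (hm : 0 < m) (hmn : m ≤ n)
    (hqn : 1 / n ≤ q) (hq1 : q ≤ 1) (hqD : q ≤ D) (hld : 0 ≤ ld) (hln : 1 / 2 ≤ ln)
    (hb : 0 ≤ b) (hc : 0 ≤ c) (he : 0 ≤ e) :
    b * √(2 * (ld + 2 * q * ln) / m) + b * √(2 * q * (ld + (c + 2) * ln) / m) + 2 * (e / n)
      ≤ (b * (c + 4) + 4 * e) * (√(D * ln / m) + √(ld / m)) := by
  have hn0 : 0 < n := by linarith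
  have hq0 : 0 < q := lt_of_lt_of_le (by positivity) hqn
  have hD0 : 0 < D := hq0.trans_le hqD
  set A := √(D * ln / m) with hA
  set E := √(ld / m) with hE
  have hA0 : 0 ≤ A := Real.sqrt_nonneg _
  have hE0 : 0 ≤ E := Real.sqrt_nonneg _
  have hA2 : A ^ 2 = D * ln / m := Real.sq_sqrt (by positivity)
  have hE2 : E ^ 2 = ld / m := Real.sq_sqrt (by positivity)
  have hqA : q * ln / m ≤ A ^ 2 := by rw [hA2]; gcongr
  have hqA0 : 0 ≤ q * ln / m := by positivity
  have h1 : √(2 * (ld + 2 * q * ln) / m) ≤ 2 * A + 2 * E := by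
    rw [Real.sqrt_le_left (by positivity)]
    have : 2 * (ld + 2 * q * ln) / m = 2 * E ^ 2 + 4 * (q * ln / m) := by rw [hE2]; ring
    nlinarith [mul_nonneg hA0 hE0, sq_nonneg E]
  have h2 : √(2 * q * (ld + (c + 2) * ln) / m) ≤ (c + 2) * A + 2 * E := by
    rw [Real.sqrt_le_left (by positivity)]
    have h3 : 2 * q * (ld + (c + 2) * ln) / m
        = 2 * (q * E ^ 2) + 2 * (c + 2) * (q * ln / m) := by rw [hE2]; ring
    have h4 : q * E ^ 2 ≤ E ^ 2 := mul_le_of_le_one_left (sq_nonneg E) hq1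
    have h5 : 2 * (c + 2) * (q * ln / m) ≤ (c + 2) ^ 2 * A ^ 2 := by
      refine mul_le_mul ?_ hqA hqA0 (sq_nonneg _)
      nlinarith
    have h6 : 0 ≤ (c + 2) * (A * E) := by positivity
    rw [h3]
    nlinarith [sq_nonneg E]
  -- Here m ≤ n enters: with q ≥ 1/n and log n ≥ 1/2 it gives A² ≥ 1/(2n²).
  have h7 : 1 / n ≤ 2 * A := by
    refine le_of_sq_le_sq ?_ (by positivity)
    have h8 : 1 / n * (1 / 2) / n ≤ q * ln / m := by gcongr
    have h9 : (1 / n) ^ 2 = 2 * (1 / n * (1 / 2) / n) := by field_simp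
    rw [h9, mul_pow]
    nlinarith
  have h10 := mul_le_mul_of_nonneg_left h1 hb
  have h11 := mul_le_mul_of_nonneg_left h2 hb
  have h12 : e / n ≤ e * (2 * A) := by
    rw [div_eq_mul_one_div]; exact mul_le_mul_of_nonneg_left h7 he
  have h13 : 0 ≤ b * c * E := by positivity
  have h14 : 0 ≤ e * E := by positivity
  nlinarith

end DRTR

/-! ### The generalization bound. -/

theorem theorem1 (d d' K : ℕ) (L B M Λ : ℝ)
    (hL : 0 ≤ L) (hB : 0 ≤ B) (hM : 0 ≤ M) (hΛ : 0 ≤ Λ) :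
    ∃ C : ℝ, 0 < C ∧
      ∀ (V : Type*) [Fintype V] (Y : Type*)
        -- observed graph, ground-truth graph, node features and labels
        (G Gstar : SimpleGraph V) (x : V → DRTR.Feat d) (y : V → Y)
        -- the parameters of DRTR
        (H : DRTR.AttnHyper) (P : DRTR.DRParams)
        (Q : ℕ → DRTR.TRParams) (cand : ℕ → Set (V × V)) (T : ℕ)
        (loss : DRTR.Feat d' → Y → ℝ) (s ε η δ : ℝ) (m : ℕ),
        -- bounded features
        (∀ v, ‖x v‖ ≤ B) →
        -- structural smoothness of the ground-truth graph
        (∀ u v, Gstar.Adj u v → ‖x u - x v‖ ^ 2 ≤ s) →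
        -- the observed graph has an `ε`-fraction of noisy edges, and they are all pruned
        ((G.edgeSet \ Gstar.edgeSet).ncard : ℝ) = ε * (G.edgeSet.ncard : ℝ) →
        (∀ v u, G.Adj v u → ¬ Gstar.Adj v u →
          u ∉ DRTR.effNbr K P x (DRTR.reconstruct Q x cand G T) v) →
        -- the added edges are valid, and are an `η`-fraction of the missing valid edges
        (DRTR.reconstruct Q x cand G T).edgeSet \ G.edgeSet ⊆ Gstar.edgeSet →
        (((DRTR.reconstruct Q x cand G T).edgeSet \ G.edgeSet).ncard : ℝ) =
          η * ((Gstar.edgeSet \ G.edgeSet).ncard : ℝ) →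
        -- Lipschitz loss, with values in `[0, M]` on the outputs of the network
        (∀ z z' a, |loss z a - loss z' a| ≤ Λ * ‖z - z'‖) →
        (∀ Θ : DRTR.Params d d' K,
          Θ.IsLipschitz H (DRTR.prunedNbr P x (DRTR.reconstruct Q x cand G T)) B L →
          ∀ v, loss (Θ.rep H (DRTR.prunedNbr P x (DRTR.reconstruct Q x cand G T)) x v) (y v)
            ∈ Set.Icc 0 M) →
        1 ≤ m → m ≤ Fintype.card V → 0 < δ → δ < 1 →
        1 - δ ≤ DRTR.labelProb m (fun VL : Finset V =>
          ∀ Θ : DRTR.Params d d' K,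
            Θ.IsLipschitz H (DRTR.prunedNbr P x (DRTR.reconstruct Q x cand G T)) B L →
            DRTR.avgLoss loss y
                (Θ.rep H (DRTR.prunedNbr P x (DRTR.reconstruct Q x cand G T)) x) Finset.univ
              ≤ DRTR.avgLoss loss y
                  (Θ.rep H (DRTR.prunedNbr P x (DRTR.reconstruct Q x cand G T)) x) VL
                + C * (Real.sqrt (DRTR.dEff K P x (DRTR.reconstruct Q x cand G T)
                          * Real.log (Fintype.card V) / VL.card)
                      + Real.sqrt (Real.log (1 / δ) / VL.card))) := by
  have hLB : 0 ≤ L * B := mul_nonneg hL hB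
  set κ : ℝ := K * (2 * (L * B) + d') with hκ
  have hκ0 : 0 ≤ κ := by positivity
  set c : ℕ := DRTR.coverExponent d d' K L B with hc
  -- M + 1 replaces M to have a positive bound on the losses even for M = 0.
  refine ⟨(M + 1) * (c + 4) + 4 * (Λ * κ), by positivity, ?_⟩
  intro V _ Y G Gstar x y H P Q cand T loss s ε η δ m hx _ _ _ _ _ hloss hrange hm hmn hδ hδ1
  set Gr := DRTR.reconstruct Q x cand G T
  set N := DRTR.prunedNbr P x Gr with hN
  set S := DRTR.activeNodes K P x Gr with hS
  have hV : 0 < Fintype.card V := by omega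
  have : Nonempty V := Fintype.card_pos_iff.1 hV
  have hn0 : (0 : ℝ) < Fintype.card V := by exact_mod_cast hV
  have hm0 : (0 : ℝ) < m := by exact_mod_cast hm
  have hlogδ : 0 ≤ Real.log (1 / δ) := Real.log_nonneg (by rw [le_div_iff₀ hδ]; linarith)
  -- The zero network is Lipschitz, so the range assumption also bounds the losses at output 0.
  have hzero : (⟨0, 0, 0, 0⟩ : DRTR.Params d d' K).IsLipschitz H N B L := by
    intro X X' _ _ v
    simp only [DRTR.Params.rep, zero_apply, Pi.zero_apply, smul_zero,
      Finset.sum_const_zero, sub_zero, norm_zero]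
    positivity
  have hbase : ∀ v, loss 0 (y v) ∈ Set.Icc 0 M := by
    intro v
    have h := hrange _ hzero v
    simpa only [DRTR.Params.rep, zero_apply, Pi.zero_apply, smul_zero,
      Finset.sum_const_zero] using h
  have hoff : ∀ (Θ : DRTR.Params d d' K), ∀ v ∉ S, Θ.rep H N x v = 0 :=
    fun Θ v hv => Θ.rep_eq_zero_of_notMem_activeNodes H P x x Gr hv
  rcases S.eq_empty_or_nonempty with hSe | hSne
  -- With no active node d_eff = 0 and the loss does not depend on Θ, so one tail bound with the
  -- log(1/δ) term suffices.
  · have htail := DRTR.labelProb_lower_tail hm hmn (fun v => loss 0 (y v)) (fun v => (hbase v).1)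
      (s := (M + 1) ^ 2) (t := (M + 1) * √(2 * Real.log (1 / δ) / m)) (by positivity)
      (by positivity) (by
        rw [div_le_iff₀ hn0]
        calc ∑ v, loss 0 (y v) ^ 2 ≤ ∑ _v : V, (M + 1) ^ 2 :=
              Finset.sum_le_sum fun v _ => pow_le_pow_left₀ (hbase v).1
                ((hbase v).2.trans (by linarith)) 2
          _ = (M + 1) ^ 2 * Fintype.card V := by simp [mul_comm])
    have hexp : Real.exp (-(m * ((M + 1) * √(2 * Real.log (1 / δ) / m)) ^ 2
        / (2 * (M + 1) ^ 2))) = δ := by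
      rw [mul_pow, Real.sq_sqrt (by positivity)]
      have : (m : ℝ) * ((M + 1) ^ 2 * (2 * Real.log (1 / δ) / m)) / (2 * (M + 1) ^ 2)
          = Real.log (1 / δ) := by field_simp
      rw [this, one_div, Real.log_inv, neg_neg, Real.exp_log hδ]
    rw [hexp] at htail
    refine le_trans ?_ (DRTR.one_sub_le_labelProb hmn (∅ : Finset Empty) (fun _ _ => False)
      (F := fun U => (M + 1) * √(2 * Real.log (1 / δ) / m)
        < (∑ v, loss 0 (y v)) / (Fintype.card V : ℝ) - (∑ v ∈ U, loss 0 (y v)) / (U.card : ℝ)) ?_)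
    · rw [Finset.sum_empty]; linarith
    · intro U hU hF _ Θ _
      have hrep : ∀ v, Θ.rep H N x v = 0 := fun v => hoff Θ v (by simp [hSe])
      simp only [DRTR.avgLoss, hrep, Finset.card_univ]
      rw [not_lt] at hF
      rw [hU] at hF ⊢
      have h1 : √(2 * Real.log (1 / δ) / m) ≤ 2 * √(Real.log (1 / δ) / m) := by
        rw [Real.sqrt_le_left (by positivity), mul_pow, Real.sq_sqrt (by positivity),
          mul_div_assoc]
        have : 0 ≤ Real.log (1 / δ) / m := by positivity
        linarith
      have h2 := mul_le_mul_of_nonneg_left h1 (by linarith : 0 ≤ M + 1)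
      have h3 := Real.sqrt_nonneg (DRTR.dEff K P x Gr * Real.log (Fintype.card V) / m)
      have h4 := Real.sqrt_nonneg (Real.log (1 / δ) / m)
      have h5 : (M + 1) * 2 * √(Real.log (1 / δ) / m)
          ≤ ((M + 1) * (c + 4) + 4 * (Λ * κ)) * √(Real.log (1 / δ) / m) := by
        refine mul_le_mul_of_nonneg_right ?_ h4
        have : 0 ≤ (M + 1) * ((c : ℝ) + 2) + 4 * (Λ * κ) := by positivity
        linarith
      have h6 : 0 ≤ ((M + 1) * (c + 4) + 4 * (Λ * κ))
          * √(DRTR.dEff K P x Gr * Real.log (Fintype.card V) / m) := by positivity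
      linarith
  · obtain ⟨v₀, hv₀⟩ := hSne
    have hn2 : 2 ≤ Fintype.card V := DRTR.two_le_card_of_mem_activeNodes hv₀
    have hn2' : (2 : ℝ) ≤ Fintype.card V := by exact_mod_cast hn2
    obtain ⟨𝒯, h𝒯card, h𝒯, hcover⟩ := DRTR.exists_finite_cover (d' := d') (K := K) H hB hL
      (fun v k l => DRTR.disjoint_prunedNbr P x Gr v k l) hx
    have hdev := DRTR.one_sub_le_labelProb_forall_mean_le 𝒯
      (fun Θ v => loss (Θ.rep H N x v) (y v)) (fun v => loss 0 (y v)) S ⟨v₀, hv₀⟩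
      (b := M + 1) (by linarith) (fun Θ hΘ v => (hrange Θ (h𝒯 Θ hΘ) v).1)
      (fun Θ hΘ v => (hrange Θ (h𝒯 Θ hΘ) v).2.trans (by linarith)) (fun v => (hbase v).1)
      (fun v => (hbase v).2.trans (by linarith))
      (fun Θ _ v hv => by rw [hoff Θ v hv]) hm hmn hn2
      (h𝒯card.trans (DRTR.mul_pow_le_pow_add hn2 _ _ _)) hδ hδ1 rfl
    refine hdev.trans (DRTR.labelProb_mono ?_)
    intro U hU hgood Θ hΘ
    obtain ⟨Θ', hΘ', hclose⟩ := hcover Θ hΘ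
    have hmean := hgood Θ' hΘ'
    -- This cover error is paid twice, in the true and in the empirical mean.
    have hl : ∀ v, |loss (Θ.rep H N x v) (y v) - loss (Θ'.rep H N x v) (y v)|
        ≤ Λ * κ / Fintype.card V := by
      intro v
      rw [mul_div_assoc]
      exact (hloss _ _ _).trans (mul_le_mul_of_nonneg_left (hclose v) hΛ)
    have havg : ∀ (U : Finset V) (f g : V → ℝ) (t : ℝ), 0 < U.card →
        (∀ v, f v ≤ g v + t) →
        (∑ v ∈ U, f v) / (U.card : ℝ) ≤ (∑ v ∈ U, g v) / (U.card : ℝ) + t := by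
      intro U f g t hU h
      have hU0 : (0 : ℝ) < U.card := by exact_mod_cast hU
      rw [div_add' _ _ _ hU0.ne']
      refine div_le_div_of_nonneg_right ?_ hU0.le
      refine (Finset.sum_le_sum fun v _ => h v).trans_eq ?_
      rw [Finset.sum_add_distrib, Finset.sum_const, nsmul_eq_mul, mul_comm t]
    have h1 := havg Finset.univ (fun v => loss (Θ.rep H N x v) (y v))
      (fun v => loss (Θ'.rep H N x v) (y v)) (Λ * κ / Fintype.card V)
      (by rw [Finset.card_univ]; exact hV) (fun v => by linarith [(abs_le.1 (hl v)).2])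
    have h2 := havg U (fun v => loss (Θ'.rep H N x v) (y v))
      (fun v => loss (Θ.rep H N x v) (y v)) (Λ * κ / Fintype.card V)
      (by omega) (fun v => by linarith [(abs_le.1 (hl v)).1])
    have hlogn : (1 : ℝ) / 2 ≤ Real.log (Fintype.card V) := by
      have := Real.log_le_log (by norm_num) hn2'
      linarith [Real.log_two_gt_d9]
    have h3 := DRTR.deviation_le (D := DRTR.dEff K P x Gr)
      (q := (S.card : ℝ) / Fintype.card V) (c := c) (e := Λ * κ) (b := M + 1)
      (ld := Real.log (1 / δ)) hn2' hm0 (by exact_mod_cast hmn)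
      (div_le_div_of_nonneg_right (by exact_mod_cast Finset.card_pos.2 ⟨v₀, hv₀⟩) hn0.le)
      (div_le_one_of_le₀ (by exact_mod_cast Finset.card_le_univ S) hn0.le)
      (DRTR.card_activeNodes_div_le_dEff K P x Gr) hlogδ hlogn (by linarith)
      (Nat.cast_nonneg c) (by positivity)
    simp only [DRTR.avgLoss]
    rw [Finset.card_univ] at h1 ⊢
    rw [hU] at hmean h2 ⊢
    simp only [DRTR.coverExponent] at hc
    rw [← hc] at hmean
    linarith
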